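/- Let $n\ge 3$ and let $p$ be a prime with $p\equiv 1 \pmod n$. Let $G=D_{2n}=\langle r,s\mid r^n,\,s^2,\,srs^{-1}r\rangle$, and let $\mathrm{Irr}_2(G)\subset\mathrm{Rep}_2(G)$ be the sets of isomorphism classes of irreducible, respectively of all, $2$-dimensional representations of $G$ over $\mathbb F_p$. Fix a primitive $n$-th root of unity $\omega\in\mathbb F_p^*$; for $i\in\mathbb Z$ let $\chi_i:\langle r\rangle\to\mathbb F_p^*$ be the character with $\chi_i(r)=\omega^i$. Every element of $\mathrm{Irr}_2(G)$ is $\theta_i=\mathrm{Ind}_{\langle r\rangle}^G\chi_i$ for a unique $1\le i<n/2$, and is given in a fixed basis by $\theta_i(r)=\begin{pmatrix}\omega^i&0\\0&\omega^{-i}\end{pmatrix}$, $\theta_i(s)=\begin{pmatrix}0&1\\1&0\end{pmatrix}$. Let $T:\mathrm{Irr}_2(G)\to\mathrm{Rep}_2(G)$ be the (well-defined) map $T(\mathrm{Ind}_{\langle r\rangle}^G\chi_i)=\mathrm{Ind}_{\langle r\rangle}^G\chi_i^2$. Put $\Omega=\mathrm{Irr}_2(G)$ if $n$ is odd and $\Omega=\mathrm{Irr}_2(G)\cap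 T(\mathrm{Irr}_2(G))$ if $n$ is even. For $\phi\in\mathrm{Irr}_2(G)$, let $1\to N\to\Gamma\to G\to 1$ be any extension of $G$ by $N=\mathbb F_p^2$ such that the conjugation action of $G=\Gamma/N$ on $N$ is $\phi$. For an irreducible $\mathbb F_pG$-module $V$, regarded as an $\mathbb F_p\Gamma$-module by inflation, put $d_V^2=\dim_{\mathbb F_p}\mathrm H^2(\Gamma,\mathrm{Hom}_{\mathbb F_p}(V,V))$. A representation $\psi\in\mathrm{Irr}_2(G)$ with module $V_\psi$ is called cohomologically maximal for $\phi$ if $d^2_{V_\psi}\ge d^2_V$ for every irreducible $\mathbb F_pG$-module $V$ (of any dimension). The fusion orbits of $\phi=\theta_i$ are the orbits of $G$ on $\mathbb F_p^2$ under the above matrices, and $\phi_1,\phi_2\in\mathrm{Irr}_2(G)$ have the same fusion if they have the same fusion orbits. (a) Let $\phi\in\Omega$. For every such extension $\Gamma$ and every $\psi\in\mathrm{Irr}_2(G)$, $\psi$ is cohomologically maximal for $\phi$ if and only if $T(\psi)=\phi$. (b) Let $n$ be odd. Then each $\phi\in\mathrm{Irr}_2(G)=\Omega$ has exactly one preimage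 $T^{-1}(\phi)$ in $\mathrm{Irr}_2(G)$, and $\phi_1,\phi_2\in\mathrm{Irr}_2(G)$ have the same fusion if and only if $T^{-1}(\phi_1)$ and $T^{-1}(\phi_2)$ have the same kernel. (c) Let $n$ be even and $\phi_1,\phi_2\in\Omega$. Then $\phi_1$ and $\phi_2$ have the same fusion if and only if $\{\ker\psi:\psi\in T^{-1}(\phi_1)\}=\{\ker\psi:\psi\in T^{-1}(\phi_2)\}$. -/

import Mathlib

namespace DihedralFusion

/-- Two-dimensional representations of the dihedral group `D_{2n}` over `𝔽_p`, on the column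
space `𝔽_p²`. Isomorphism of such representations is `Nonempty (φ.Equiv ψ)`. -/
abbrev Rep2 (n p : ℕ) : Type :=
  Representation (ZMod p) (DihedralGroup n) (Fin 2 → ZMod p)

/-- The subgroup `⟨r⟩` of rotations in `D_{2n}`. -/
abbrev rotations (n : ℕ) : Subgroup (DihedralGroup n) :=
  Subgroup.zpowers (DihedralGroup.r (1 : ZMod n))

/-- The one-dimensional representation of `⟨r⟩` on `𝔽_p` given by the character `χ`. -/
noncomputable def charRep {n p : ℕ} (χ : rotations n →* (ZMod p)ˣ) :
    Representation (ZMod p) (rotations n) (ZMod p) where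
  toFun g := (χ g : ZMod p) • LinearMap.id
  map_one' := by ext; simp
  map_mul' g h := by ext; simp [mul_comm]

/-- The representation `Ind χ` of `D_{2n}` induced from the character `χ` of `⟨r⟩`. -/
noncomputable abbrev indChar {n p : ℕ} (χ : rotations n →* (ZMod p)ˣ) :
    Representation (ZMod p) (DihedralGroup n)
      (Representation.IndV (rotations n).subtype (charRep χ)) :=
  Representation.ind (rotations n).subtype (charRep χ)

/-- The graph of the map `T : Ind χ ↦ Ind χ²` on isomorphism classes: `IsT ψ φ` says that
`T(ψ) = φ` as isomorphism classes. It is used for irreducible `ψ` only. -/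
def IsT {n p : ℕ} (ψ φ : Rep2 n p) : Prop :=
  ∃ χ : rotations n →* (ZMod p)ˣ,
    Nonempty (ψ.Equiv (indChar χ)) ∧ Nonempty (φ.Equiv (indChar (χ ^ 2)))

/-- Membership in `Ω`: this is `Irr₂` if `n` is odd and `Irr₂ ∩ T(Irr₂)` if `n` is even. -/
def InOmega {n p : ℕ} [Fact p.Prime] (φ : Rep2 n p) : Prop :=
  φ.IsIrreducible ∧ (Even n → ∃ ψ : Rep2 n p, ψ.IsIrreducible ∧ IsT ψ φ)

/-- The action of `G` on `N` by conjugation in the extension `1 → N → Γ → G → 1` is `φ`. -/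
def ActsBy {p : ℕ} {Γ G N : Type} [Group Γ] [Group G] [AddCommGroup N] [Module (ZMod p) N]
    (S : GroupExtension (Multiplicative N) Γ G) (φ : Representation (ZMod p) G N) : Prop :=
  ∀ (γ : Γ) (x : N), γ * S.inl (Multiplicative.ofAdd x) * γ⁻¹ =
    S.inl (Multiplicative.ofAdd (φ (S.rightHom γ) x))

/-- `d²_V = dim H²(Γ, Hom(V, V))` over `𝔽_p`, where `V` is the space of the representation `ρ`
of `G`, inflated to `Γ` along `π : Γ → G`. -/
noncomputable def d2 {p : ℕ} {Γ G V : Type} [Group Γ] [Group G] [AddCommGroup V]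
    [Module (ZMod p) V] (π : Γ →* G) (ρ : Representation (ZMod p) G V) : ℕ :=
  Module.finrank (ZMod p) (groupCohomology (Rep.of ((ρ.linHom ρ).comp π)) 2)

/-- The representation `ψ` is cohomologically maximal: `d²_ψ` is maximal among the numbers `d²_V`
of all irreducible representations `V` of `G` over `𝔽_p` (of any dimension). -/
def IsCohomologicallyMaximal {p : ℕ} [Fact p.Prime] {Γ G W : Type} [Group Γ] [Group G]
    [AddCommGroup W] [Module (ZMod p) W] (π : Γ →* G) (ψ : Representation (ZMod p) G W) : Prop :=
  ∀ (V : Type) [AddCommGroup V] [Module (ZMod p) V] (ρ : Representation (ZMod p) G V),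
    ρ.IsIrreducible → d2 π ρ ≤ d2 π ψ

/-- The fusion orbits of `φ`: the orbits of the action `φ` of `G` on `N`. -/
def fusionOrbits {p : ℕ} {G N : Type} [Group G] [AddCommGroup N] [Module (ZMod p) N]
    (φ : Representation (ZMod p) G N) : Set (Set N) :=
  Set.range fun x : N => Set.range fun g : G => φ g x

/-- `φ` is written in the fixed basis: `r ↦ diag(ζ, ζ⁻¹)` and `s ↦ (0 1; 1 0)`, for some
`ζ ∈ 𝔽_p^*` (necessarily an `n`-th root of unity). -/
def IsStandardForm {n p : ℕ} (φ : Rep2 n p) : Prop :=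
  ∃ ζ : (ZMod p)ˣ,
    φ (DihedralGroup.r 1) = Matrix.toLin' !![(ζ : ZMod p), 0; 0, ((ζ⁻¹ : (ZMod p)ˣ) : ZMod p)] ∧
    φ (DihedralGroup.sr 0) = Matrix.toLin' !![0, 1; 1, 0]

/-- The isomorphism classes of `φ₁` and `φ₂` have the same fusion: written in the fixed basis,
they have the same fusion orbits on `N = 𝔽_p²`. The standard form of an irreducible class is
unique up to replacing `ζ` by `ζ⁻¹`, which does not change the orbits. -/
def HaveSameFusion {n p : ℕ} (φ₁ φ₂ : Rep2 n p) : Prop :=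
  ∃ φ₁' φ₂' : Rep2 n p, Nonempty (φ₁.Equiv φ₁') ∧ Nonempty (φ₂.Equiv φ₂') ∧
    IsStandardForm φ₁' ∧ IsStandardForm φ₂' ∧ fusionOrbits φ₁' = fusionOrbits φ₂'

end DihedralFusion

open DihedralFusion

/-! Everything is read off from one parameter. Since `p ≡ 1 [MOD n]`, the rotation `r` is
diagonalisable over `𝔽_p`, and an irreducible representation is either a line or has a basis swapped
by `s` on which `r` acts as `diag(ζ, ζ⁻¹)`. The parameter `ζ` is unique up to inversion,
irreducibility means `ζ ^ 2 ≠ 1`, and `T` squares the parameter.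

Part (a). Let `φ` have parameter `ζ` and let `M` be a `G`-module inflated to `Γ`. As `p` does not
divide `|G|`, the group `H²(Γ, M)` is the `G`-invariant part of `H²(N, M)`: averaging shows that
restriction to `N` is injective (`IsInflCocycle.exists_eq_coboundary`), and a Schur–Zassenhaus
complement extends equivariant cocycles to `Γ` (`ActsBy.exists_extend`). For odd `p`, a class on `N`
is determined by the `p`-th power map `N → M` and the commutator pairing `Λ²N → M` of the
corresponding central extension (`IsAddCocycle.exists_eq_coboundary`). Equivariance reduces the
first to a vector `u` with `r u = ζ u`, and the second to a vector `v` with `r v = v`, `s v = -v`.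
Every such pair occurs, by an explicit cocycle built from Teichmüller carries and the determinant.
Hence `finrank_cohomology_eq`.

For `M = End V`, with `V` of parameter `η`, the eigenvalues of `r` are `1` on diagonal matrices and
`η ^ 2`, `η⁻¹ ^ 2` on the two off-diagonal entries. So `v` is a multiple of `diag(1, -1)`, and `u`
is nonzero only if `ζ` is `η ^ 2` or its inverse, that is, if `T(V) = φ`. The dimension is 2 in that
case, at most 1 for other two-dimensional `V`, and 0 for lines. Membership in `Ω` guarantees that
the value 2 is attained.

Parts (b) and (c). The fusion orbits determine and are determined by `⟨ζ⟩`, hence by the order of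
`ζ`; likewise the kernel of a representation is determined by the order of its parameter. It remains
to compare the orders of elements and of their squares. For odd `n` squaring preserves orders. For
even `n` the preimages of `ζ` have parameters `η` and `-η`, and `orderOf_eq_or_eq_neg` matches the
orders. -/

namespace DihedralFusion

set_option linter.unusedSectionVars false

/-! ### Cocycles on an abelian group with trivial action: commutators and powers. -/

section TrivialAction

variable {N M : Type*} [AddCommGroup N] [AddCommGroup M]

/-- The 2-cocycle identity for functions on an abelian group with trivial action. -/
def IsAddCocycle (f : N → N → M) : Prop :=
  ∀ x y z, f (x + y) z + f x y = f y z + f x (y + z)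

/-- The sum `∑_{i < m} f(ix, x)`: up to normalisation, the `m`-th multiple of a lift of `x` in the
extension given by `f`. -/
def multSum (f : N → N → M) (m : ℕ) (x : N) : M :=
  ∑ i ∈ Finset.range m, f (i • x) x

namespace IsAddCocycle

variable {f : N → N → M}

theorem zero_left (hf : IsAddCocycle f) (x : N) : f 0 x = f 0 0 := by
  have := hf 0 0 x
  simp only [add_zero, zero_add] at this
  exact (add_left_cancel this).symm

theorem zero_right (hf : IsAddCocycle f) (x : N) : f x 0 = f 0 0 := by
  have := hf x 0 0
  simp only [add_zero] at this
  exact add_right_cancel this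

theorem swap (hf : IsAddCocycle f) : IsAddCocycle fun x y => f y x := by
  intro x y z
  have := hf z y x
  rw [add_comm z y, add_comm y x] at this
  linear_combination (norm := module) -this

theorem add {g : N → N → M} (hf : IsAddCocycle f) (hg : IsAddCocycle g) :
    IsAddCocycle fun x y => f x y + g x y := by
  intro x y z
  linear_combination (norm := module) hf x y z + hg x y z

/-- The antisymmetrisation of `f` is the commutator pairing of the central extension defined by `f`,
hence additive in each variable. -/
theorem alt_add_left (hf : IsAddCocycle f) (x y z : N) :
    f (x + y) z - f z (x + y) = (f x z - f z x) + (f y z - f z y) := by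
  have h1 := hf x y z
  have h2 := hf z x y
  have h3 := hf x z y
  rw [add_comm z x] at h2
  rw [add_comm z y] at h3
  linear_combination (norm := module) h1 - h3 + h2

theorem alt_nsmul_left (hf : IsAddCocycle f) (m : ℕ) (x z : N) :
    f (m • x) z - f z (m • x) = m • (f x z - f z x) := by
  induction m with
  | zero => simp [hf.zero_left, hf.zero_right]
  | succ m ih => rw [succ_nsmul, hf.alt_add_left, ih, succ_nsmul]

/-- In the abelian extension defined by a symmetric `f`, both sides compare the two groupings
`(ab)(xy)` and `(ax)(by)` of a product of lifts. -/
theorem four_term (hf : IsAddCocycle f) (hs : ∀ x y, f x y = f y x) (a b x y : N) :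
    f (a + b) (x + y) + f x y + f a b = f a x + f b y + f (a + x) (b + y) := by
  have h1 := hf (a + b) x y
  have h2 := hf b a x
  have h3 := hf (a + x) b y
  have h4 := hf b x y
  have e1 : b + (a + x) = a + b + x := by abel
  have e2 : a + x + b = a + b + x := by abel
  rw [e2] at h3
  rw [add_comm b a] at h2
  rw [hs b a] at h2
  rw [hs b (a + x)] at h2
  linear_combination (norm := module) -h1 + h3 + h2

/-- Taking `m`-th powers is a homomorphism in an abelian extension; the other terms account for `f x
y` and for `f` not being normalised. -/
theorem multSum_add (hf : IsAddCocycle f) (hs : ∀ x y, f x y = f y x) (m : ℕ) (x y : N) :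
    multSum f m (x + y) + m • f x y + f 0 0 = multSum f m x + multSum f m y + f (m • x) (m • y) := by
  induction m with
  | zero => simp [multSum]
  | succ m ih =>
    have h := hf.four_term hs (m • x) (m • y) x y
    simp only [multSum, Finset.sum_range_succ] at ih ⊢
    rw [succ_nsmul, succ_nsmul, succ_nsmul, smul_add]
    linear_combination (norm := module) ih + h

theorem multSum_add_left (hf : IsAddCocycle f) (i j : ℕ) (x : N) :
    multSum f (i + j) x + f 0 0 = multSum f i x + multSum f j x + f (i • x) (j • x) := by
  induction j with
  | zero => simp [multSum, hf.zero_right]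
  | succ j ih =>
    have h := hf (i • x) (j • x) x
    rw [← add_assoc]
    simp only [multSum, Finset.sum_range_succ] at ih ⊢
    rw [add_nsmul, succ_nsmul]
    linear_combination (norm := module) ih + h

end IsAddCocycle

end TrivialAction

/-! ### Classes on `𝔽_p²`: the power and commutator invariants are complete. -/

section ModP

variable {p : ℕ} [Fact p.Prime] {N M : Type*} [AddCommGroup N] [Module (ZMod p) N]
  [AddCommGroup M] [Module (ZMod p) M]

theorem nsmul_char_eq_zero (x : M) : p • x = 0 := by
  rw [← Nat.cast_smul_eq_nsmul (ZMod p)]; simp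

theorem zmod_smul_eq_val_nsmul (a : ZMod p) (x : M) : a • x = a.val • x := by
  conv_lhs => rw [← ZMod.natCast_zmod_val a]
  rw [Nat.cast_smul_eq_nsmul]

theorem eq_zero_of_two_nsmul (hp : p ≠ 2) {x : M} (h : x + x = 0) : x = 0 := by
  have : (2 : ZMod p) ≠ 0 := by
    intro h2
    have : (p : ℕ) ∣ 2 := (ZMod.natCast_eq_zero_iff 2 p).1 (by exact_mod_cast h2)
    exact hp ((Nat.prime_dvd_prime_iff_eq Fact.out Nat.prime_two).1 this)
  rw [← two_smul (ZMod p)] at h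
  exact (smul_eq_zero.1 h).resolve_left this

namespace IsAddCocycle

variable {f : N → N → M}

theorem multSum_char_add_of_symm (hf : IsAddCocycle f) (hs : ∀ x y, f x y = f y x) (x y : N) :
    multSum f p (x + y) = multSum f p x + multSum f p y := by
  have h := hf.multSum_add hs p x y
  simp only [nsmul_char_eq_zero, add_zero] at h
  exact add_right_cancel h

/-- Symmetrising `f` doubles the sum, because the commutator pairing of `i • x` with `x` vanishes.
The symmetric case then suffices after division by two. In characteristic two the map would only be
quadratic. -/
theorem multSum_char_add (hp : p ≠ 2) (hf : IsAddCocycle f) (x y : N) :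
    multSum f p (x + y) = multSum f p x + multSum f p y := by
  have key : ∀ x, multSum (fun x y => f x y + f y x) p x = multSum f p x + multSum f p x := by
    intro x
    rw [multSum, Finset.sum_add_distrib, multSum]
    congr 1
    refine Finset.sum_congr rfl fun i _ => ?_
    have := hf.alt_nsmul_left i x x
    rw [sub_self, smul_zero, sub_eq_zero] at this
    exact this.symm
  have h := (hf.add hf.swap).multSum_char_add_of_symm (p := p) (fun x y => add_comm _ _) x y
  rw [key, key, key] at h
  rw [← sub_eq_zero]
  apply eq_zero_of_two_nsmul hp
  linear_combination (norm := module) h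

theorem multSum_char_nsmul (hp : p ≠ 2) (hf : IsAddCocycle f) (m : ℕ) (x : N) :
    multSum f p (m • x) = m • multSum f p x :=
  map_nsmul (AddMonoidHom.mk' (multSum f p) (hf.multSum_char_add hp)) m x

/-- By `multSum_add_left`, each further block of `p` terms contributes `multSum f p x = 0`, the two
values `f 0 0` cancelling. -/
theorem multSum_mod (hf : IsAddCocycle f) {x : N} (hx : multSum f p x = 0) (m : ℕ) :
    multSum f (m % p) x = multSum f m x := by
  have key : ∀ k r, multSum f (r + p * k) x = multSum f r x := by
    intro k r
    induction k with
    | zero => simp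
    | succ k ih =>
      have h := hf.multSum_add_left (r + p * k) p x
      rw [hx, nsmul_char_eq_zero (p := p) x, hf.zero_right (_ • x), ih, add_zero] at h
      rw [mul_add, mul_one, ← add_assoc]
      exact add_right_cancel h
  conv_rhs => rw [← Nat.mod_add_div m p]
  exact (key _ _).symm

/-- Thus, on the line through `x`, `f` is the coboundary of `a ↦ f 0 0 - multSum f a.val x`;
periodicity is what makes this compatible with addition in `ZMod p`. -/
theorem line_eq (hf : IsAddCocycle f) {x : N} (hx : multSum f p x = 0) (a b : ZMod p) :
    f (a • x) (b • x) = multSum f (a + b).val x + f 0 0 - multSum f a.val x - multSum f b.val x := by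
  rw [ZMod.val_add, hf.multSum_mod hx, hf.multSum_add_left, zmod_smul_eq_val_nsmul a,
    zmod_smul_eq_val_nsmul b]
  abel

/-- A cocycle on a two-dimensional space whose commutator and `p`-th power invariants vanish is a
coboundary. -/
theorem exists_eq_coboundary (hf : IsAddCocycle f) (b : Module.Basis (Fin 2) (ZMod p) N)
    (halt : f (b 0) (b 1) = f (b 1) (b 0)) (h0 : multSum f p (b 0) = 0)
    (h1 : multSum f p (b 1) = 0) : ∃ h : N → M, ∀ x y, f x y = h x + h y - h (x + y) := by
  have repr : ∀ x : N, x = b.repr x 0 • b 0 + b.repr x 1 • b 1 := fun x => by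
    conv_lhs => rw [← b.sum_repr x, Fin.sum_univ_two]
  have asm : ∀ (a : ZMod p) (x z : N), f (a • x) z - f z (a • x) = a • (f x z - f z x) :=
    fun a x z => by rw [zmod_smul_eq_val_nsmul, hf.alt_nsmul_left, zmod_smul_eq_val_nsmul]
  have asm' : ∀ (a : ZMod p) (x z : N), f z (a • x) - f (a • x) z = a • (f z x - f x z) :=
    fun a x z => by rw [← neg_sub, asm, ← smul_neg, neg_sub]
  have hb : ∀ i j, f (b i) (b j) - f (b j) (b i) = 0 := by
    intro i j
    fin_cases i <;> fin_cases j <;> simp [halt]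
  -- The commutator pairing is bilinear and vanishes on pairs of basis vectors.
  have hs : ∀ x y, f x y = f y x := by
    have h1 : ∀ i x, f x (b i) - f (b i) x = 0 := by
      intro i x
      rw [repr x, hf.alt_add_left, asm, asm, hb, hb]
      simp
    intro x y
    rw [← sub_eq_zero, repr x, hf.alt_add_left, asm, asm, ← neg_sub, ← neg_sub (f y (b 1)),
      h1, h1]
    simp
  -- `q i` is the primitive on the `i`-th coordinate line from `line_eq`; `four_term` glues the two,
  -- at the cost of the mixed term `f (x₀ b₀) (x₁ b₁)`.
  let q : Fin 2 → ZMod p → M := fun i a => f 0 0 - multSum f a.val (b i)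
  refine ⟨fun x => q 0 (b.repr x 0) + q 1 (b.repr x 1) -
    f (b.repr x 0 • b 0) (b.repr x 1 • b 1), fun x y => ?_⟩
  have h4 := hf.four_term hs (b.repr x 0 • b 0) (b.repr x 1 • b 1) (b.repr y 0 • b 0)
    (b.repr y 1 • b 1)
  rw [← repr x, ← repr y, ← add_smul, ← add_smul, hf.line_eq h0, hf.line_eq h1] at h4
  simp only [map_add, Finsupp.add_apply, q]
  linear_combination (norm := module) h4

end IsAddCocycle

end ModP

/-- First isomorphism theorem, applied to two maps out of the cocycles with the same kernel. It
allows `H²` to be computed by invariants of cocycles. -/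
theorem finrank_groupCohomology_two_eq {k G W : Type} [Field k] [Group G] [AddCommGroup W]
    [Module k W] (A : Rep.{0} k G) (Ψ : groupCohomology.cocycles₂ A →ₗ[k] W)
    (h : ∀ f, Ψ f = 0 ↔ ⇑f ∈ groupCohomology.coboundaries₂ A) :
    Module.finrank k (groupCohomology A 2) = Module.finrank k (LinearMap.range Ψ) := by
  have hs : Function.Surjective (groupCohomology.H2π A).hom :=
    (ModuleCat.epi_iff_surjective _).1 inferInstance
  have hk : LinearMap.ker (groupCohomology.H2π A).hom = LinearMap.ker Ψ := by
    ext f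
    rw [LinearMap.mem_ker, LinearMap.mem_ker, h]
    exact groupCohomology.H2π_eq_zero_iff f
  exact LinearEquiv.finrank_eq (((LinearMap.quotKerEquivOfSurjective _ hs).symm.trans
    (Submodule.quotEquivOfEq _ _ hk)).trans Ψ.quotKerEquivRange)

/-! ### Cohomology of an extension with quotient of order prime to `p`. -/

section Extension

variable {p : ℕ} [Fact p.Prime] {Γ G N M : Type} [Group Γ] [Group G] [AddCommGroup N]
  [Module (ZMod p) N] [AddCommGroup M] [Module (ZMod p) M]
  (S : GroupExtension (Multiplicative N) Γ G) (φ : Representation (ZMod p) G N)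
  (σ : Representation (ZMod p) G M)

/-- The inclusion of the kernel in additive notation. -/
def kerIncl (x : N) : Γ := S.inl (Multiplicative.ofAdd x)

theorem kerIncl_add (x y : N) : kerIncl S (x + y) = kerIncl S x * kerIncl S y := by
  simp [kerIncl]

theorem kerIncl_zero : kerIncl S 0 = 1 := by
  simp [kerIncl]

theorem rightHom_kerIncl (x : N) : S.rightHom (kerIncl S x) = 1 := by
  simp [kerIncl]

theorem exists_eq_mul_kerIncl {γ δ : Γ} (h : S.rightHom γ = S.rightHom δ) :
    ∃ x, γ = δ * kerIncl S x := by
  have : δ⁻¹ * γ ∈ S.inl.range := by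
    rw [S.range_inl_eq_ker_rightHom, MonoidHom.mem_ker]
    simp [h]
  obtain ⟨x, hx⟩ := this
  exact ⟨x.toAdd, by simp [kerIncl, hx]⟩

/-- The 2-cocycle condition for `Γ` acting on `M` through `G`. -/
def IsInflCocycle (f : Γ × Γ → M) : Prop :=
  ∀ g h j, f (g * h, j) + f (g, h) = σ (S.rightHom g) (f (h, j)) + f (g, h * j)

/-- The restriction of a 2-cochain to the kernel of the extension. -/
def restrKer (f : Γ × Γ → M) (x y : N) : M := f (kerIncl S x, kerIncl S y)

variable {S φ σ}

theorem ActsBy.mul_kerIncl (hS : ActsBy S φ) (γ : Γ) (x : N) :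
    γ * kerIncl S x = kerIncl S (φ (S.rightHom γ) x) * γ := by
  rw [kerIncl, kerIncl, ← hS]; simp

namespace IsInflCocycle

variable {f : Γ × Γ → M}

theorem restrKer (hf : IsInflCocycle S σ f) : IsAddCocycle (restrKer S f) := by
  intro x y z
  have := hf (kerIncl S x) (kerIncl S y) (kerIncl S z)
  rw [rightHom_kerIncl, map_one] at this
  simpa [DihedralFusion.restrKer, kerIncl_add] using this

theorem one_left (hf : IsInflCocycle S σ f) (γ : Γ) : f (1, γ) = f (1, 1) := by
  have := hf 1 1 γ
  simp only [mul_one, one_mul, map_one, Module.End.one_apply] at this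
  exact (add_left_cancel this).symm

theorem one_right (hf : IsInflCocycle S σ f) (γ : Γ) :
    f (γ, 1) = σ (S.rightHom γ) (f (1, 1)) := by
  have := hf γ 1 1
  simp only [mul_one] at this
  exact add_right_cancel this

/-- Conjugation by `γ` acts trivially on the cohomology of `Γ`, so the restricted class is
`G`-invariant. The primitive is the usual one, `f(γ, x) - f(γxγ⁻¹, γ)`. -/
theorem restrKer_conj (hf : IsInflCocycle S σ f) (hS : ActsBy S φ) (γ : Γ) :
    ∃ h : N → M, ∀ x y, σ (S.rightHom γ) (DihedralFusion.restrKer S f x y) =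
      DihedralFusion.restrKer S f (φ (S.rightHom γ) x) (φ (S.rightHom γ) y) +
        (h x + h y - h (x + y)) := by
  refine ⟨fun x => f (γ, kerIncl S x) - f (kerIncl S (φ (S.rightHom γ) x), γ), fun x y => ?_⟩
  have h1 := hf γ (kerIncl S x) (kerIncl S y)
  have h2 := hf (kerIncl S (φ (S.rightHom γ) x)) γ (kerIncl S y)
  have h3 := hf (kerIncl S (φ (S.rightHom γ) x)) (kerIncl S (φ (S.rightHom γ) y)) γ
  rw [← kerIncl_add, hS.mul_kerIncl] at h1
  rw [rightHom_kerIncl, map_one, Module.End.one_apply, hS.mul_kerIncl] at h2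
  rw [rightHom_kerIncl, map_one, Module.End.one_apply, ← kerIncl_add] at h3
  simp only [DihedralFusion.restrKer, map_add]
  linear_combination (norm := module) -h1 + h2 - h3

/-- The coboundary in `restrKer_conj` is symmetric in `x` and `y`, so it disappears on
antisymmetrising. -/
theorem alt_equivariant (hf : IsInflCocycle S σ f) (hS : ActsBy S φ) (g : G) (x y : N) :
    σ g (DihedralFusion.restrKer S f x y - DihedralFusion.restrKer S f y x) =
      DihedralFusion.restrKer S f (φ g x) (φ g y) -
        DihedralFusion.restrKer S f (φ g y) (φ g x) := by
  obtain ⟨γ, rfl⟩ := S.rightHom_surjective g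
  obtain ⟨h, hh⟩ := hf.restrKer_conj hS γ
  rw [map_sub, hh, hh, add_comm y x]
  abel

theorem multSum_equivariant (hf : IsInflCocycle S σ f) (hS : ActsBy S φ) (g : G) (x : N) :
    σ g (multSum (DihedralFusion.restrKer S f) p x) =
      multSum (DihedralFusion.restrKer S f) p (φ g x) := by
  obtain ⟨γ, rfl⟩ := S.rightHom_surjective g
  obtain ⟨h, hh⟩ := hf.restrKer_conj hS γ
  -- A coboundary telescopes along multiples of `x`; at `m = p` nothing remains, since `p` kills
  -- both `M` and `N`.
  have tel : ∀ m : ℕ, ∑ i ∈ Finset.range m, (h (i • x) + h x - h (i • x + x)) =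
      m • h x + h 0 - h (m • x) := by
    intro m
    induction m with
    | zero => simp
    | succ m ih => rw [Finset.sum_range_succ, ih, succ_nsmul, succ_nsmul]; abel
  simp only [multSum, map_sum, hh, Finset.sum_add_distrib, tel, map_nsmul]
  simp [nsmul_char_eq_zero (p := p)]

/-- Averaging over the quotient: a cocycle which vanishes on `Γ × N` is a coboundary. -/
theorem exists_eq_coboundary_of_vanish [Finite G] (hG : (Nat.card G : ZMod p) ≠ 0)
    (hf : IsInflCocycle S σ f) (h0 : ∀ γ x, f (γ, kerIncl S x) = 0) :
    ∃ k : Γ → M, ∀ γ δ, f (γ, δ) = σ (S.rightHom γ) (k δ) - k (γ * δ) + k γ := by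
  have := Fintype.ofFinite G
  obtain ⟨t, ht⟩ := S.rightHom_surjective.hasRightInverse
  have hcoset : ∀ γ δ x, f (γ, δ * kerIncl S x) = f (γ, δ) := by
    intro γ δ x
    have := hf γ δ (kerIncl S x)
    rw [h0, h0, map_zero, zero_add, zero_add] at this
    exact this.symm
  -- Modulo `N` the second argument of `f` does not matter, so this is a sum over `G`. Summing the
  -- cocycle identity over its last argument makes `|G| • f` the coboundary of `b`.
  let b : Γ → M := fun γ => ∑ g, f (γ, t g)
  have hb : ∀ γ δ, b (γ * δ) + (Nat.card G : ZMod p) • f (γ, δ) =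
      σ (S.rightHom γ) (b δ) + b γ := by
    intro γ δ
    have e : b γ = ∑ g, f (γ, δ * t g) := by
      simp only [b]
      rw [← Equiv.sum_comp (Equiv.mulLeft (S.rightHom δ)) fun g => f (γ, t g)]
      refine Finset.sum_congr rfl fun g _ => ?_
      obtain ⟨x, hx⟩ := exists_eq_mul_kerIncl S (γ := t (S.rightHom δ * g)) (δ := δ * t g)
        (by rw [ht, map_mul, ht])
      rw [Equiv.coe_mulLeft, hx, hcoset]
    simp only [b] at e ⊢
    rw [e, map_sum, ← Finset.sum_add_distrib, Nat.card_eq_fintype_card, Nat.cast_smul_eq_nsmul,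
      ← Finset.card_univ, ← Finset.sum_const, ← Finset.sum_add_distrib]
    exact Finset.sum_congr rfl fun g _ => hf γ δ (t g)
  refine ⟨fun γ => (Nat.card G : ZMod p)⁻¹ • b γ, fun γ δ => ?_⟩
  rw [map_smul, ← smul_sub, ← smul_add, eq_inv_smul_iff₀ hG]
  linear_combination (norm := module) hb γ δ

/-- A cocycle is a coboundary if its restriction to `N` is one. -/
theorem exists_eq_coboundary [Finite G] (hG : (Nat.card G : ZMod p) ≠ 0)
    (hf : IsInflCocycle S σ f) {h : N → M}
    (hh : ∀ x y, DihedralFusion.restrKer S f x y = h x + h y - h (x + y)) :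
    ∃ k : Γ → M, ∀ γ δ, f (γ, δ) = σ (S.rightHom γ) (k δ) - k (γ * δ) + k γ := by
  classical
  obtain ⟨t₀, ht₀⟩ := S.rightHom_surjective.hasRightInverse
  -- The section is normalised at `1`, so that `k₁` below restricts to `h` on `N`.
  let t := Function.update t₀ 1 1
  have t1 : t 1 = 1 := Function.update_self ..
  have ht : ∀ g, S.rightHom (t g) = g := by
    intro g
    by_cases hg : g = 1
    · rw [hg, t1, map_one]
    · simp only [t, Function.update_of_ne hg]; exact ht₀ g
  have hx : ∀ γ, ∃ x, γ = t (S.rightHom γ) * kerIncl S x := fun γ =>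
    exists_eq_mul_kerIncl S (ht _).symm
  choose ξ hξ using hx
  have inj : ∀ {x y : N}, kerIncl S x = kerIncl S y → x = y := fun {x y} e =>
    Multiplicative.ofAdd.injective (S.inl_injective e)
  have hξt : ∀ g x, ξ (t g * kerIncl S x) = x := by
    intro g x
    have := hξ (t g * kerIncl S x)
    rw [map_mul, rightHom_kerIncl, mul_one, ht] at this
    exact (inj (mul_left_cancel this)).symm
  -- Chosen so that subtracting its coboundary kills `f` on all pairs `(t g, x)` with `x ∈ N` and on
  -- `N × N`. The cocycle identity then kills it on `Γ × N`. The term `f (1, 1)` compensates for `f`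
  -- not being normalised.
  let k₁ : Γ → M := fun γ =>
    σ (S.rightHom γ) (h (ξ γ)) - f (t (S.rightHom γ), kerIncl S (ξ γ)) + f (1, 1)
  have h00 : h 0 = f (1, 1) := by
    have := hh 0 0
    rw [DihedralFusion.restrKer, kerIncl_zero, add_zero] at this
    rw [this]; abel
  have k₁t : ∀ g x, k₁ (t g * kerIncl S x) = σ g (h x) - f (t g, kerIncl S x) + f (1, 1) := by
    intro g x
    simp only [k₁, hξt, map_mul, rightHom_kerIncl, mul_one, ht]
  have k₁ker : ∀ x, k₁ (kerIncl S x) = h x := by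
    intro x
    have := k₁t 1 x
    rw [t1, one_mul, map_one, Module.End.one_apply, hf.one_left] at this
    rw [this]; abel
  let f' : Γ × Γ → M := fun q => f q - (σ (S.rightHom q.1) (k₁ q.2) - k₁ (q.1 * q.2) + k₁ q.1)
  have hf' : IsInflCocycle S σ f' := by
    intro a b c
    simp only [f', map_sub, map_add, map_mul, Module.End.mul_apply, mul_assoc]
    linear_combination (norm := module) hf a b c
  have ht' : ∀ g x, f' (t g, kerIncl S x) = 0 := by
    intro g x
    have e := k₁t g 0
    rw [kerIncl_zero, mul_one, h00, hf.one_right (t g), ht] at e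
    simp only [f', k₁ker, k₁t, ht, e]
    abel
  have h0 : ∀ γ x, f' (γ, kerIncl S x) = 0 := by
    intro γ x
    have e := hf' (t (S.rightHom γ)) (kerIncl S (ξ γ)) (kerIncl S x)
    have e2 : f' (kerIncl S (ξ γ), kerIncl S x) = 0 := by
      have := hh (ξ γ) x
      simp only [f', ← kerIncl_add, k₁ker, rightHom_kerIncl, map_one, Module.End.one_apply]
      rw [DihedralFusion.restrKer] at this
      rw [this]; abel
    rw [← hξ, e2, ← kerIncl_add, ht', ht', map_zero, add_zero, add_zero] at e
    exact e
  obtain ⟨k₂, hk₂⟩ := hf'.exists_eq_coboundary_of_vanish hG h0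
  refine ⟨fun γ => k₁ γ + k₂ γ, fun γ δ => ?_⟩
  have := hk₂ γ δ
  simp only [f'] at this
  rw [map_add]
  linear_combination (norm := module) this

end IsInflCocycle

/-- If the orders of `N` and `G` are coprime, there is a crossed homomorphism `Γ → N` extending the
identity of `N`. -/
theorem ActsBy.exists_crossedHom (hS : ActsBy S φ) (hc : (Nat.card N).Coprime (Nat.card G)) :
    ∃ ν : Γ → N, (∀ x, ν (kerIncl S x) = x) ∧
      ∀ γ δ, ν (γ * δ) = ν γ + φ (S.rightHom γ) (ν δ) := by
  have hcop : (Nat.card S.inl.range).Coprime S.inl.range.index := by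
    have h1 : Nat.card S.inl.range = Nat.card N :=
      Nat.card_congr ((MonoidHom.ofInjective S.inl_injective).toEquiv.symm.trans
        Multiplicative.toAdd)
    have h2 : S.inl.range.index = Nat.card G :=
      Nat.card_congr S.quotientRangeInlEquivRight.toEquiv
    rwa [h1, h2]
  -- Schur–Zassenhaus: `H` is a complement of `N`, and `ν γ` will be the `N`-component of `γ`.
  obtain ⟨H, hH⟩ := Subgroup.exists_right_complement'_of_coprime hcop
  have hdec : ∀ γ, ∃ x, (kerIncl S x)⁻¹ * γ ∈ H := by
    intro γ
    obtain ⟨⟨⟨n, x, hx⟩, h⟩, hγ⟩ := hH.2 γ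
    refine ⟨x.toAdd, ?_⟩
    have : kerIncl S x.toAdd = n := by simpa [kerIncl] using hx
    rw [this, ← hγ]
    simp
  have huniq : ∀ x y γ, (kerIncl S x)⁻¹ * γ ∈ H → (kerIncl S y)⁻¹ * γ ∈ H → x = y := by
    intro x y γ hx hy
    have := @hH.1 (⟨kerIncl S x, _, rfl⟩, ⟨_, hx⟩) (⟨kerIncl S y, _, rfl⟩, ⟨_, hy⟩) (by simp)
    have e : kerIncl S x = kerIncl S y := congrArg (fun q => (q.1 : Γ)) this
    exact Multiplicative.ofAdd.injective (S.inl_injective e)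
  choose ν hν using hdec
  refine ⟨ν, fun x => huniq _ _ _ (hν _) (by simp [H.one_mem]), fun γ δ => ?_⟩
  refine huniq _ _ _ (hν _) ?_
  have e : (kerIncl S (ν γ + φ (S.rightHom γ) (ν δ)))⁻¹ * (γ * δ) =
      ((kerIncl S (ν γ))⁻¹ * γ) * ((kerIncl S (ν δ))⁻¹ * δ) := by
    have h1 := hS.mul_kerIncl ((kerIncl S (ν γ))⁻¹ * γ) (ν δ)
    rw [map_mul, map_inv, rightHom_kerIncl, inv_one, one_mul] at h1
    have h2 : (kerIncl S (φ (S.rightHom γ) (ν δ)))⁻¹ * ((kerIncl S (ν γ))⁻¹ * γ) =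
        (kerIncl S (ν γ))⁻¹ * γ * (kerIncl S (ν δ))⁻¹ := by
      rw [inv_mul_eq_iff_eq_mul, ← mul_assoc, ← h1, mul_inv_cancel_right]
    rw [kerIncl_add, mul_inv_rev, mul_assoc, ← mul_assoc _ γ δ, ← mul_assoc, h2, mul_assoc]
  rw [e]
  exact H.mul_mem (hν γ) (hν δ)

/-- An equivariant cocycle on `N` extends to `Γ`. -/
theorem ActsBy.exists_extend (hS : ActsBy S φ) (hc : (Nat.card N).Coprime (Nat.card G))
    {c : N → N → M} (hadd : IsAddCocycle c) (heq : ∀ g x y, c (φ g x) (φ g y) = σ g (c x y)) :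
    ∃ f : Γ × Γ → M, IsInflCocycle S σ f ∧ restrKer S f = c := by
  obtain ⟨ν, hν, hν'⟩ := hS.exists_crossedHom hc
  -- The pullback of `c` along the crossed homomorphism `ν`; equivariance of `c` turns its additive
  -- cocycle identity into the twisted one.
  refine ⟨fun q => c (ν q.1) (φ (S.rightHom q.1) (ν q.2)), fun a b d => ?_, ?_⟩
  · simp only [hν', map_add, map_mul, Module.End.mul_apply, ← heq]
    exact hadd _ _ _
  · ext x y
    simp [restrKer, hν, rightHom_kerIncl]

end Extension

/-! ### A homogeneous carry cocycle from Teichmüller lifts. -/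

section Carry

variable {p : ℕ} [Fact p.Prime]

/-- A lift of `a` to the integers which modulo `p²` is the Teichmüller representative. -/
def teichLift (a : ZMod p) : ℤ := (a.val : ℤ) ^ p

theorem intCast_teichLift (a : ZMod p) : (teichLift a : ZMod p) = a := by
  simp [teichLift, ZMod.pow_card]

/-- Integers congruent modulo `p` have `p`-th powers congruent modulo `p²`. -/
theorem teichLift_mul_modEq (a b : ZMod p) :
    (p : ℤ) ^ 2 ∣ teichLift (a * b) - teichLift a * teichLift b := by
  have h : (p : ℤ) ∣ ((a * b).val : ℤ) - (a.val : ℤ) * b.val := by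
    rw [← ZMod.intCast_eq_intCast_iff_dvd_sub]
    simp
  have := dvd_sub_pow_of_dvd_sub (p := p) h 1
  rw [pow_one, mul_pow] at this
  exact this

theorem dvd_teichLift_add_sub (a b : ZMod p) :
    (p : ℤ) ∣ teichLift a + teichLift b - teichLift (a + b) := by
  rw [← ZMod.intCast_zmod_eq_zero_iff_dvd _ p]
  push_cast
  simp [intCast_teichLift]

/-- The carry of Teichmüller lifts, as an integer. -/
def carryInt (a b : ZMod p) : ℤ := (teichLift a + teichLift b - teichLift (a + b)) / p

theorem mul_carryInt (a b : ZMod p) :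
    (p : ℤ) * carryInt a b = teichLift a + teichLift b - teichLift (a + b) :=
  Int.mul_ediv_cancel' (dvd_teichLift_add_sub a b)

/-- The carry cocycle of Teichmüller lifts: it describes the extension `ℤ/p²` of `ℤ/p` by `ℤ/p` and
is homogeneous of degree one. -/
def carry (a b : ZMod p) : ZMod p := carryInt a b

theorem natCast_prime_ne_zero : (p : ℤ) ≠ 0 := by
  exact_mod_cast (Fact.out : p.Prime).ne_zero

/-- Before division by `p` the integral carry is a coboundary, and the identity survives cancelling
`p` in `ℤ`. -/
theorem carry_isAddCocycle : IsAddCocycle (carry (p := p)) := by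
  intro a b c
  simp only [carry]
  rw [← Int.cast_add, ← Int.cast_add]
  congr 1
  apply mul_left_cancel₀ (natCast_prime_ne_zero (p := p))
  rw [mul_add, mul_add, mul_carryInt, mul_carryInt, mul_carryInt, mul_carryInt, add_assoc a b c]
  ring

/-- Multiplicativity of the lift modulo `p²` survives as homogeneity modulo `p` after division.
Carries of least residues lack this property, which is needed for equivariance under `r`. -/
theorem carry_mul (t a b : ZMod p) : carry (t * a) (t * b) = t * carry a b := by
  have h : (p : ℤ) ∣ carryInt (t * a) (t * b) - teichLift t * carryInt a b := by
    apply Int.dvd_of_mul_dvd_mul_left (natCast_prime_ne_zero (p := p))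
    rw [← sq, mul_sub, mul_left_comm, mul_carryInt, mul_carryInt, ← mul_add t]
    have e : teichLift (t * a) + teichLift (t * b) - teichLift (t * (a + b)) -
        teichLift t * (teichLift a + teichLift b - teichLift (a + b)) =
        (teichLift (t * a) - teichLift t * teichLift a) +
        (teichLift (t * b) - teichLift t * teichLift b) -
        (teichLift (t * (a + b)) - teichLift t * teichLift (a + b)) := by ring
    rw [e]
    exact ((teichLift_mul_modEq t a).add (teichLift_mul_modEq t b)).sub
      (teichLift_mul_modEq t (a + b))
  rw [← ZMod.intCast_zmod_eq_zero_iff_dvd _ p] at h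
  push_cast at h
  rw [intCast_teichLift, sub_eq_zero] at h
  exact h

theorem teichLift_zero : teichLift (0 : ZMod p) = 0 := by
  simp [teichLift, (Fact.out : p.Prime).ne_zero]

theorem carry_zero_left (a : ZMod p) : carry 0 a = 0 := by
  simp [carry, carryInt, teichLift_zero]

theorem carry_zero_right (a : ZMod p) : carry a 0 = 0 := by
  simp [carry, carryInt, teichLift_zero]

/-- The `p`-th power invariant of the carry at `1`: multiplied by `p`, the sum telescopes to `p`
over the integers. -/
theorem sum_carry_one : ∑ i ∈ Finset.range p, carry (i : ZMod p) 1 = 1 := by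
  have tel : ∀ m : ℕ, (p : ℤ) * ∑ i ∈ Finset.range m, carryInt (i : ZMod p) 1 =
      m - teichLift (m : ZMod p) := by
    intro m
    induction m with
    | zero => simp [teichLift_zero]
    | succ m ih =>
      have : Fact (1 < p) := ⟨(Fact.out : p.Prime).one_lt⟩
      have h1 : teichLift (1 : ZMod p) = 1 := by simp [teichLift, ZMod.val_one]
      rw [Finset.sum_range_succ, mul_add, ih, mul_carryInt, h1]
      push_cast
      ring
  have h := tel p
  rw [ZMod.natCast_self, teichLift_zero, sub_zero] at h
  have h' := mul_left_cancel₀ (natCast_prime_ne_zero (p := p)) (h.trans (mul_one _).symm)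
  simp only [carry]
  rw [← Int.cast_sum, h', Int.cast_one]

end Carry

/-- Products suffice because the group is finite; the identity arises as `s²`. -/
theorem dihedral_induction {n : ℕ} [NeZero n] {P : DihedralGroup n → Prop}
    (hmul : ∀ a b, P a → P b → P (a * b)) (hr : P (DihedralGroup.r 1))
    (hs : P (DihedralGroup.sr 0)) (g : DihedralGroup n) : P g := by
  have h1 : P 1 := by
    have := hmul _ _ hs hs
    simpa using this
  have hrk : ∀ i : ZMod n, P (DihedralGroup.r i) := by
    intro i
    have : ∀ k : ℕ, P (DihedralGroup.r 1 ^ k) := by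
      intro k
      induction k with
      | zero => simpa using h1
      | succ k ih => rw [pow_succ]; exact hmul _ _ ih hr
    have h := this i.val
    rwa [DihedralGroup.r_one_pow, ZMod.natCast_zmod_val] at h
  cases g with
  | r i => exact hrk i
  | sr i =>
    have := hmul _ _ hs (hrk i)
    rwa [DihedralGroup.sr_mul_r, zero_add] at this

/-! ### The second cohomology of `Γ` in terms of eigenvectors in `M`. -/

section Dihedral

variable {n p : ℕ} [NeZero n] [Fact p.Prime] {Γ N M : Type} [Group Γ] [AddCommGroup N]
  [Module (ZMod p) N] [AddCommGroup M] [Module (ZMod p) M]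
  {S : GroupExtension (Multiplicative N) Γ (DihedralGroup n)}
  {φ : Representation (ZMod p) (DihedralGroup n) N}
  {σ : Representation (ZMod p) (DihedralGroup n) M}

/-- The basis `b` brings `φ` into the form `r ↦ diag(ζ, ζ⁻¹)`, `s ↦ (0 1; 1 0)`. -/
structure IsStdBasis (φ : Representation (ZMod p) (DihedralGroup n) N)
    (b : Module.Basis (Fin 2) (ZMod p) N) (ζ : (ZMod p)ˣ) : Prop where
  r_zero : φ (DihedralGroup.r 1) (b 0) = (ζ : ZMod p) • b 0
  r_one : φ (DihedralGroup.r 1) (b 1) = ((ζ⁻¹ : (ZMod p)ˣ) : ZMod p) • b 1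
  s_zero : φ (DihedralGroup.sr 0) (b 0) = b 1
  s_one : φ (DihedralGroup.sr 0) (b 1) = b 0

theorem map_sr_map_r (u : M) :
    σ (DihedralGroup.r 1) (σ (DihedralGroup.sr 0) (σ (DihedralGroup.r 1) u)) =
      σ (DihedralGroup.sr 0) u := by
  simp only [← Module.End.mul_apply, ← map_mul]
  simp

theorem map_sr_map_sr (u : M) :
    σ (DihedralGroup.sr 0) (σ (DihedralGroup.sr 0) u) = u := by
  simp only [← Module.End.mul_apply, ← map_mul]
  simp

/-- The explicit equivariant cocycle on `N` with prescribed invariants. -/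
theorem exists_equivariant_cocycle {b : Module.Basis (Fin 2) (ZMod p) N} {ζ : (ZMod p)ˣ}
    (hb : IsStdBasis φ b ζ) {u v : M}
    (hu : σ (DihedralGroup.r 1) u = (ζ : ZMod p) • u) (hv : σ (DihedralGroup.r 1) v = v)
    (hv' : σ (DihedralGroup.sr 0) v = -v) :
    ∃ c : N → N → M, IsAddCocycle c ∧ (∀ g x y, c (φ g x) (φ g y) = σ g (c x y)) ∧
      multSum c p (b 0) = u ∧ c (b 0) (b 1) - c (b 1) (b 0) = v + v := by
  set u' := σ (DihedralGroup.sr 0) u with hu'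
  have hru' : σ (DihedralGroup.r 1) u' = ((ζ⁻¹ : (ZMod p)ˣ) : ZMod p) • u' := by
    have := map_sr_map_r (σ := σ) u
    rw [hu, map_smul, map_smul, ← hu'] at this
    rw [← this, smul_smul, Units.inv_mul, one_smul, this]
  have hsu' : σ (DihedralGroup.sr 0) u' = u := map_sr_map_sr u
  have repr : ∀ x : N, x = b.repr x 0 • b 0 + b.repr x 1 • b 1 := fun x => by
    conv_lhs => rw [← b.sum_repr x, Fin.sum_univ_two]
  have hr0 : ∀ x, b.repr (φ (DihedralGroup.r 1) x) 0 = ζ * b.repr x 0 := by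
    intro x
    conv_lhs => rw [repr x, map_add, map_smul, map_smul, hb.r_zero, hb.r_one]
    simp only [map_add, map_smul, Finsupp.add_apply, Finsupp.smul_apply, b.repr_self, smul_eq_mul,
      Finsupp.single_apply, if_true, if_false, Fin.reduceEq]
    ring
  have hr1 : ∀ x, b.repr (φ (DihedralGroup.r 1) x) 1 = (ζ⁻¹ : (ZMod p)ˣ) * b.repr x 1 := by
    intro x
    conv_lhs => rw [repr x, map_add, map_smul, map_smul, hb.r_zero, hb.r_one]
    simp only [map_add, map_smul, Finsupp.add_apply, Finsupp.smul_apply, b.repr_self, smul_eq_mul,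
      Finsupp.single_apply, if_true, if_false, Fin.reduceEq]
    ring
  have hs0 : ∀ x, b.repr (φ (DihedralGroup.sr 0) x) 0 = b.repr x 1 := by
    intro x
    conv_lhs => rw [repr x, map_add, map_smul, map_smul, hb.s_zero, hb.s_one]
    simp
  have hs1 : ∀ x, b.repr (φ (DihedralGroup.sr 0) x) 1 = b.repr x 0 := by
    intro x
    conv_lhs => rw [repr x, map_add, map_smul, map_smul, hb.s_zero, hb.s_one]
    simp
  -- The two carries produce a power map sending `b 0` to `u` and `b 1` to `s u`. The determinant is
  -- fixed by `r` and negated by `s`, matching the behaviour of `v`.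
  refine ⟨fun x y => carry (b.repr x 0) (b.repr y 0) • u + carry (b.repr x 1) (b.repr y 1) • u' +
    (b.repr x 0 * b.repr y 1 - b.repr x 1 * b.repr y 0) • v, ?_, ?_, ?_, ?_⟩
  · intro x y z
    have h0 := carry_isAddCocycle (b.repr x 0) (b.repr y 0) (b.repr z 0)
    have h1 := carry_isAddCocycle (b.repr x 1) (b.repr y 1) (b.repr z 1)
    simp only [map_add, Finsupp.add_apply]
    linear_combination (norm := module) h0 • u + h1 • u'
  · intro g
    induction g using dihedral_induction with
    | hmul g h ihg ihh =>
      intro x y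
      simp only [map_mul, Module.End.mul_apply]
      rw [← ihh, ← ihg]
    | hr =>
      intro x y
      simp only [hr0, hr1, carry_mul, map_add, map_smul, hu, hru', hv]
      have e : (ζ : ZMod p) * ((ζ⁻¹ : (ZMod p)ˣ) : ZMod p) = 1 := Units.mul_inv ζ
      generalize ((ζ⁻¹ : (ZMod p)ˣ) : ZMod p) = w at e ⊢
      match_scalars
      · ring
      · ring
      · linear_combination (b.repr x 0 * b.repr y 1 - b.repr x 1 * b.repr y 0) * e
    | hs =>
      intro x y
      simp only [hs0, hs1, map_add, map_smul, ← hu', hsu', hv']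
      module
  · simp only [multSum, map_nsmul, Finsupp.smul_apply, b.repr_self]
    simp [carry_zero_left, ← Finset.sum_smul, sum_carry_one]
  · simp [carry_zero_left, carry_zero_right, sub_eq_add_neg]

theorem IsAddCocycle.alt_smul_left {f : N → N → M} (hf : IsAddCocycle f) (a : ZMod p) (x z : N) :
    f (a • x) z - f z (a • x) = a • (f x z - f z x) := by
  rw [zmod_smul_eq_val_nsmul, hf.alt_nsmul_left, zmod_smul_eq_val_nsmul]

theorem IsAddCocycle.alt_smul_right {f : N → N → M} (hf : IsAddCocycle f) (a : ZMod p) (x z : N) :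
    f z (a • x) - f (a • x) z = a • (f z x - f x z) := by
  rw [← neg_sub, hf.alt_smul_left, ← smul_neg, neg_sub]

variable (σ) in
/-- The target of the invariants of classes in `H²(Γ, M)`. -/
def invariantPairs (ζ : (ZMod p)ˣ) : Submodule (ZMod p) (M × M) :=
  (Module.End.eigenspace (σ (DihedralGroup.r 1)) (ζ : ZMod p)).prod
    (Module.End.eigenspace (σ (DihedralGroup.r 1)) 1 ⊓
      Module.End.eigenspace (σ (DihedralGroup.sr 0)) (-1))

theorem mem_invariantPairs {ζ : (ZMod p)ˣ} {q : M × M} : q ∈ invariantPairs σ ζ ↔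
    σ (DihedralGroup.r 1) q.1 = (ζ : ZMod p) • q.1 ∧ σ (DihedralGroup.r 1) q.2 = q.2 ∧
      σ (DihedralGroup.sr 0) q.2 = -q.2 := by
  simp [invariantPairs, Submodule.mem_prod]

/-- `H²(Γ, M)` for an extension `Γ` of the dihedral group by a standard module `N`. -/
theorem finrank_cohomology_eq (hp2 : p ≠ 2) (hpn : p.Coprime n) (hS : ActsBy S φ)
    {b : Module.Basis (Fin 2) (ZMod p) N} {ζ : (ZMod p)ˣ} (hb : IsStdBasis φ b ζ) :
    Module.finrank (ZMod p) (groupCohomology (Rep.of (σ.comp S.rightHom)) 2) =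
      Module.finrank (ZMod p) (invariantPairs σ ζ) := by
  have hcop : p.Coprime (Nat.card (DihedralGroup n)) := by
    rw [DihedralGroup.nat_card]
    exact Nat.Coprime.mul_right ((Nat.coprime_primes Fact.out Nat.prime_two).2 hp2) hpn
  have hcard : (Nat.card (DihedralGroup n) : ZMod p) ≠ 0 := by
    rw [Ne, ZMod.natCast_eq_zero_iff]
    exact fun h => (Fact.out : p.Prime).one_lt.ne' (Nat.eq_one_of_dvd_coprimes hcop dvd_rfl h)
  have hN : (Nat.card N).Coprime (Nat.card (DihedralGroup n)) := by
    rw [Nat.card_congr b.equivFun.toEquiv]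
    simp only [Nat.card_eq_fintype_card, Fintype.card_fun, Fintype.card_fin, ZMod.card]
    rw [← Nat.card_eq_fintype_card]
    exact hcop.pow_left 2
  let A := Rep.of (σ.comp S.rightHom)
  have hcoc : ∀ f : groupCohomology.cocycles₂ A, IsInflCocycle S σ f := fun f =>
    (groupCohomology.mem_cocycles₂_iff _).1 f.2
  let Ψ : groupCohomology.cocycles₂ A →ₗ[ZMod p] M × M :=
    { toFun f := (multSum (restrKer S f) p (b 0),
        restrKer S f (b 0) (b 1) - restrKer S f (b 1) (b 0))
      map_add' f g := by
        ext
        · exact Finset.sum_add_distrib (s := Finset.range p) (f := fun i : ℕ => restrKer S f (i • b 0) (b 0))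
            (g := fun i : ℕ => restrKer S g (i • b 0) (b 0))
        · exact add_sub_add_comm (restrKer S f (b 0) (b 1)) (restrKer S g (b 0) (b 1)) _ _
      map_smul' a f := by
        ext
        · exact (Finset.smul_sum (r := a) (s := Finset.range p)
            (f := fun i : ℕ => restrKer S f (i • b 0) (b 0))).symm
        · exact (smul_sub a (restrKer S f (b 0) (b 1)) _).symm }
  have hΨ : ∀ f, Ψ f = (multSum (restrKer S f) p (b 0),
      restrKer S f (b 0) (b 1) - restrKer S f (b 1) (b 0)) := fun _ => rfl
  have hrange : LinearMap.range Ψ = invariantPairs σ ζ := by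
    ext ⟨u, v⟩
    constructor
    · rintro ⟨f, hf⟩
      have hr := (hcoc f).restrKer
      rw [mem_invariantPairs, ← hf, hΨ]
      refine ⟨?_, ?_, ?_⟩
      · rw [(hcoc f).multSum_equivariant hS, hb.r_zero, zmod_smul_eq_val_nsmul,
          hr.multSum_char_nsmul hp2, ← zmod_smul_eq_val_nsmul]
      · rw [(hcoc f).alt_equivariant hS, hb.r_zero, hb.r_one, hr.alt_smul_left, hr.alt_smul_right,
          smul_smul, Units.mul_inv, one_smul]
      · rw [(hcoc f).alt_equivariant hS, hb.s_zero, hb.s_one, neg_sub]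
    · intro h
      obtain ⟨hu, hv, hv'⟩ := mem_invariantPairs.1 h
      have two : (2 : ZMod p) ≠ 0 := by
        intro h2
        have : (p : ℕ) ∣ 2 := (ZMod.natCast_eq_zero_iff 2 p).1 (by exact_mod_cast h2)
        exact hp2 ((Nat.prime_dvd_prime_iff_eq Fact.out Nat.prime_two).1 this)
      -- Antisymmetrising the determinant doubles it, hence the factor `2⁻¹`.
      obtain ⟨c, hc, heq, h1, h2⟩ := exists_equivariant_cocycle (v := (2 : ZMod p)⁻¹ • v) hb hu
        (by rw [map_smul, hv]) (by rw [map_smul, hv', smul_neg])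
      obtain ⟨f, hf, hfc⟩ := hS.exists_extend hN hc heq
      refine ⟨⟨f, (groupCohomology.mem_cocycles₂_iff _).2 hf⟩, ?_⟩
      rw [hΨ]
      have e : restrKer S (⟨f, (groupCohomology.mem_cocycles₂_iff _).2 hf⟩ :
        groupCohomology.cocycles₂ A) = c := hfc
      rw [e, h1, h2, ← two_smul (ZMod p), smul_inv_smul₀ two]
  rw [← hrange]
  refine finrank_groupCohomology_two_eq A Ψ fun f => ?_
  have hr := (hcoc f).restrKer
  constructor
  · intro h
    rw [hΨ, Prod.mk_eq_zero] at h
    -- Since `b 1 = s (b 0)`, equivariance gives the vanishing at the second basis vector for free.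
    have h1 : multSum (restrKer S f) p (b 1) = 0 := by
      rw [← hb.s_zero, ← (hcoc f).multSum_equivariant hS, h.1, map_zero]
    obtain ⟨k, hk⟩ := hr.exists_eq_coboundary b (sub_eq_zero.1 h.2) h.1 h1
    obtain ⟨l, hl⟩ := (hcoc f).exists_eq_coboundary hcard hk
    exact ⟨l, funext fun q => (hl q.1 q.2).symm⟩
  · rintro ⟨l, hl⟩
    have hk : ∀ x y, restrKer S f x y =
        l (kerIncl S y) - l (kerIncl S (x + y)) + l (kerIncl S x) := by
      intro x y
      have := congrFun hl (kerIncl S x, kerIncl S y)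
      rw [kerIncl_add]
      refine this.symm.trans ?_
      change σ (S.rightHom (kerIncl S x)) (l (kerIncl S y)) - _ + _ = _
      rw [rightHom_kerIncl, map_one]
      rfl
    have tel : ∀ m : ℕ, multSum (restrKer S f) m (b 0) =
        m • l (kerIncl S (b 0)) + l (kerIncl S 0) - l (kerIncl S (m • b 0)) := by
      intro m
      induction m with
      | zero => simp [multSum]
      | succ m ih =>
        rw [multSum, Finset.sum_range_succ, ← multSum, ih, hk, succ_nsmul, succ_nsmul]; abel
    rw [hΨ, Prod.mk_eq_zero]
    constructor
    · rw [tel]; simp [nsmul_char_eq_zero (p := p)]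
    · rw [hk, hk, add_comm (b 1)]; abel

end Dihedral

/-! ### Classification of the irreducible representations by their parameter. -/

section StandardBasis

variable {n p : ℕ} [NeZero n] [Fact p.Prime] {V W : Type} [AddCommGroup V] [Module (ZMod p) V]
  [AddCommGroup W] [Module (ZMod p) W] {ρ : Representation (ZMod p) (DihedralGroup n) V}
  {τ : Representation (ZMod p) (DihedralGroup n) W} {ζ ξ : (ZMod p)ˣ}

/-- The representation `ρ` has the standard form `r ↦ diag(ζ, ζ⁻¹)`, `s ↦ (0 1; 1 0)` in some
basis. -/
def HasStdBasis (ρ : Representation (ZMod p) (DihedralGroup n) V) (ζ : (ZMod p)ˣ) : Prop :=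
  ∃ b : Module.Basis (Fin 2) (ZMod p) V, IsStdBasis ρ b ζ

theorem intertwining_of_generators (e : V →ₗ[ZMod p] W)
    (hr : ∀ x, e (ρ (DihedralGroup.r 1) x) = τ (DihedralGroup.r 1) (e x))
    (hs : ∀ x, e (ρ (DihedralGroup.sr 0) x) = τ (DihedralGroup.sr 0) (e x))
    (g : DihedralGroup n) (x : V) : e (ρ g x) = τ g (e x) := by
  induction g using dihedral_induction generalizing x with
  | hmul g h ihg ihh => simp only [map_mul, Module.End.mul_apply, ihg, ihh]
  | hr => exact hr x
  | hs => exact hs x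

theorem HasStdBasis.of_equiv (h : HasStdBasis ρ ζ) (e : ρ.Equiv τ) : HasStdBasis τ ζ := by
  obtain ⟨b, hb⟩ := h
  have he : ∀ g x, τ g (e x) = e (ρ g x) := fun g x =>
    (Representation.IntertwiningMap.isIntertwining _ _ e.toIntertwiningMap g x).symm
  have hB : ∀ i, b.map e.toLinearEquiv i = e (b i) := fun i => rfl
  refine ⟨b.map e.toLinearEquiv, ⟨?_, ?_, ?_, ?_⟩⟩
  · rw [hB, he, hb.r_zero, map_smul]
  · rw [hB, he, hb.r_one, map_smul]
  · rw [hB, he, hb.s_zero, hB]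
  · rw [hB, he, hb.s_one, hB]

theorem HasStdBasis.nonempty_equiv (h : HasStdBasis ρ ζ) (h' : HasStdBasis τ ζ) :
    Nonempty (ρ.Equiv τ) := by
  obtain ⟨b, hb⟩ := h
  obtain ⟨c, hc⟩ := h'
  have hE : ∀ i, (b.equiv c (Equiv.refl _)).toLinearMap (b i) = c i := fun i => by simp
  have hr : (b.equiv c (Equiv.refl _)).toLinearMap ∘ₗ ρ (DihedralGroup.r 1) =
      τ (DihedralGroup.r 1) ∘ₗ (b.equiv c (Equiv.refl _)).toLinearMap := by
    refine b.ext fun i => ?_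
    rw [LinearMap.comp_apply, LinearMap.comp_apply, hE]
    fin_cases i
    · change _ = τ _ (c 0)
      change (b.equiv c (Equiv.refl _)).toLinearMap (ρ _ (b 0)) = _
      rw [hb.r_zero, hc.r_zero, map_smul, hE]
    · change _ = τ _ (c 1)
      change (b.equiv c (Equiv.refl _)).toLinearMap (ρ _ (b 1)) = _
      rw [hb.r_one, hc.r_one, map_smul, hE]
  have hs : (b.equiv c (Equiv.refl _)).toLinearMap ∘ₗ ρ (DihedralGroup.sr 0) =
      τ (DihedralGroup.sr 0) ∘ₗ (b.equiv c (Equiv.refl _)).toLinearMap := by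
    refine b.ext fun i => ?_
    rw [LinearMap.comp_apply, LinearMap.comp_apply, hE]
    fin_cases i
    · change _ = τ _ (c 0)
      change (b.equiv c (Equiv.refl _)).toLinearMap (ρ _ (b 0)) = _
      rw [hb.s_zero, hc.s_zero, hE]
    · change _ = τ _ (c 1)
      change (b.equiv c (Equiv.refl _)).toLinearMap (ρ _ (b 1)) = _
      rw [hb.s_one, hc.s_one, hE]
  exact ⟨Representation.Equiv.mk (b.equiv c (Equiv.refl _)) fun g => LinearMap.ext fun x =>
    intertwining_of_generators (b.equiv c (Equiv.refl _)).toLinearMap (LinearMap.congr_fun hr)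
      (LinearMap.congr_fun hs) g x⟩

theorem HasStdBasis.inv (h : HasStdBasis ρ ζ) : HasStdBasis ρ ζ⁻¹ := by
  obtain ⟨b, hb⟩ := h
  have h0 : b.reindex (Equiv.swap 0 1) 0 = b 1 := by simp
  have h1 : b.reindex (Equiv.swap 0 1) 1 = b 0 := by simp
  exact ⟨b.reindex (Equiv.swap 0 1), ⟨by rw [h0, hb.r_one], by rw [h1, hb.r_zero, inv_inv],
    by rw [h0, h1, hb.s_one], by rw [h0, h1, hb.s_zero]⟩⟩

theorem IsStdBasis.pow_eq_one {b : Module.Basis (Fin 2) (ZMod p) V} (h : IsStdBasis ρ b ζ) :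
    ζ ^ n = 1 := by
  have key : ∀ k : ℕ, ρ (DihedralGroup.r 1 ^ k) (b 0) = ((ζ : ZMod p) ^ k) • b 0 := by
    intro k
    induction k with
    | zero => simp
    | succ k ih =>
      rw [pow_succ, map_mul, Module.End.mul_apply, h.r_zero, map_smul, ih, smul_smul, pow_succ']
  have := key n
  rw [DihedralGroup.r_one_pow_n, map_one, Module.End.one_apply] at this
  have h2 : ((ζ : ZMod p) ^ n - 1) • b 0 = 0 := by rw [sub_smul, ← this, one_smul, sub_self]
  ext
  exact sub_eq_zero.1 ((smul_eq_zero.1 h2).resolve_right (b.ne_zero 0))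

theorem HasStdBasis.pow_eq_one (h : HasStdBasis ρ ζ) : ζ ^ n = 1 :=
  h.elim fun _ hb => hb.pow_eq_one

theorem basis_eq_add (b : Module.Basis (Fin 2) (ZMod p) V) (x : V) :
    x = b.repr x 0 • b 0 + b.repr x 1 • b 1 := by
  conv_lhs => rw [← b.sum_repr x, Fin.sum_univ_two]

theorem IsStdBasis.r_apply {b : Module.Basis (Fin 2) (ZMod p) V} (h : IsStdBasis ρ b ζ) (x : V) :
    ρ (DihedralGroup.r 1) x =
      (ζ * b.repr x 0) • b 0 + (((ζ⁻¹ : (ZMod p)ˣ) : ZMod p) * b.repr x 1) • b 1 := by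
  conv_lhs => rw [basis_eq_add b x, map_add, map_smul, map_smul, h.r_zero, h.r_one]
  module

theorem IsStdBasis.repr_r_zero {b : Module.Basis (Fin 2) (ZMod p) V} (h : IsStdBasis ρ b ζ)
    (x : V) : b.repr (ρ (DihedralGroup.r 1) x) 0 = ζ * b.repr x 0 := by
  rw [h.r_apply]
  simp only [map_add, map_smul, Finsupp.add_apply, Finsupp.smul_apply, b.repr_self, smul_eq_mul,
      Finsupp.single_apply, if_true, if_false, Fin.reduceEq, mul_one, mul_zero, add_zero]

theorem IsStdBasis.repr_r_one {b : Module.Basis (Fin 2) (ZMod p) V} (h : IsStdBasis ρ b ζ)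
    (x : V) : b.repr (ρ (DihedralGroup.r 1) x) 1 = (ζ⁻¹ : (ZMod p)ˣ) * b.repr x 1 := by
  rw [h.r_apply]
  simp only [map_add, map_smul, Finsupp.add_apply, Finsupp.smul_apply, b.repr_self, smul_eq_mul,
      Finsupp.single_apply, if_true, if_false, Fin.reduceEq, mul_one, mul_zero, zero_add]

theorem IsStdBasis.s_apply {b : Module.Basis (Fin 2) (ZMod p) V} (h : IsStdBasis ρ b ζ) (x : V) :
    ρ (DihedralGroup.sr 0) x = b.repr x 1 • b 0 + b.repr x 0 • b 1 := by
  conv_lhs => rw [basis_eq_add b x, map_add, map_smul, map_smul, h.s_zero, h.s_one]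
  module

theorem IsStdBasis.repr_s_one {b : Module.Basis (Fin 2) (ZMod p) V} (h : IsStdBasis ρ b ζ)
    (x : V) : b.repr (ρ (DihedralGroup.sr 0) x) 1 = b.repr x 0 := by
  rw [h.s_apply]
  simp only [map_add, map_smul, Finsupp.add_apply, Finsupp.smul_apply, b.repr_self, smul_eq_mul,
      Finsupp.single_apply, if_true, if_false, Fin.reduceEq, mul_one, mul_zero, zero_add]

/-- `c 0` is an eigenvector of `r` with eigenvalue `ξ`, and `r` has only the eigenvalues `ζ` and
`ζ⁻¹`. -/
theorem HasStdBasis.eq_or_eq_inv (h : HasStdBasis ρ ζ) (h' : HasStdBasis ρ ξ) :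
    ξ = ζ ∨ ξ = ζ⁻¹ := by
  obtain ⟨b, hb⟩ := h
  obtain ⟨c, hc⟩ := h'
  have h0 := hb.repr_r_zero (c 0)
  have h1 := hb.repr_r_one (c 0)
  rw [hc.r_zero, map_smul, Finsupp.smul_apply, smul_eq_mul] at h0 h1
  by_cases hx : b.repr (c 0) 0 = 0
  · by_cases hy : b.repr (c 0) 1 = 0
    · exfalso
      apply c.ne_zero 0
      rw [basis_eq_add b (c 0), hx, hy]; simp
    · exact Or.inr (Units.ext (mul_right_cancel₀ hy h1))
  · exact Or.inl (Units.ext (mul_right_cancel₀ hx h0))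

/-- A nonzero subspace of an irreducible representation stable under the generators is
everything. -/
theorem eq_top_of_stable (hρ : ρ.IsIrreducible) (U : Submodule (ZMod p) V)
    (hr : ∀ x ∈ U, ρ (DihedralGroup.r 1) x ∈ U) (hs : ∀ x ∈ U, ρ (DihedralGroup.sr 0) x ∈ U)
    {x : V} (hx : x ∈ U) (hx0 : x ≠ 0) : U = ⊤ := by
  let U' : Subrepresentation ρ := ⟨U, fun g => by
    induction g using dihedral_induction with
    | hmul g h ihg ihh =>
      intro v hv
      rw [map_mul, Module.End.mul_apply]
      exact ihg (ihh hv)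
    | hr => exact fun v hv => hr v hv
    | hs => exact fun v hv => hs v hv⟩
  have := hρ
  rcases eq_bot_or_eq_top U' with h | h
  · have : U = ⊥ := congrArg Subrepresentation.toSubmodule h
    rw [this, Submodule.mem_bot] at hx
    exact absurd hx hx0
  · exact congrArg Subrepresentation.toSubmodule h

theorem exists_ne_zero_of_irreducible (hρ : ρ.IsIrreducible) : ∃ x : V, x ≠ 0 := by
  by_contra! h
  have := hρ
  obtain ⟨A, B, hAB⟩ := exists_pair_ne (Subrepresentation ρ)
  apply hAB
  apply Subrepresentation.toSubmodule_injective
  ext x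
  rw [h x]
  simp

theorem finrank_eq_one_of_stable (hρ : ρ.IsIrreducible) {x : V} (hx0 : x ≠ 0) {a c : ZMod p}
    (hr : ρ (DihedralGroup.r 1) x = a • x) (hs : ρ (DihedralGroup.sr 0) x = c • x) :
    Module.finrank (ZMod p) V = 1 := by
  have hmem := Submodule.mem_span_singleton_self (R := ZMod p) x
  have h := eq_top_of_stable hρ (Submodule.span (ZMod p) {x})
    (fun y hy => by
      obtain ⟨t, rfl⟩ := Submodule.mem_span_singleton.1 hy
      rw [map_smul, hr]
      exact Submodule.smul_mem _ _ (Submodule.smul_mem _ _ hmem))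
    (fun y hy => by
      obtain ⟨t, rfl⟩ := Submodule.mem_span_singleton.1 hy
      rw [map_smul, hs]
      exact Submodule.smul_mem _ _ (Submodule.smul_mem _ _ hmem)) hmem hx0
  refine finrank_eq_one x hx0 fun w => ?_
  exact Submodule.mem_span_singleton.1 (h ▸ Submodule.mem_top)

/-- If `ζ = ζ⁻¹` then `r` is scalar, and `b 0 + b 1` spans a stable line. -/
theorem HasStdBasis.sq_ne_one (h : HasStdBasis ρ ζ) (hρ : ρ.IsIrreducible) : ζ ^ 2 ≠ 1 := by
  intro hz
  obtain ⟨b, hb⟩ := h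
  have hinv : ζ⁻¹ = ζ := inv_eq_of_mul_eq_one_left (by rw [← sq, hz])
  have hne : b 0 + b 1 ≠ 0 := by
    intro h0
    have := congrArg (fun x => b.repr x 0) h0
    simp at this
  have := finrank_eq_one_of_stable (a := ζ) (c := 1) hρ hne
    (by rw [map_add, hb.r_zero, hb.r_one, hinv, smul_add])
    (by rw [map_add, hb.s_zero, hb.s_one, one_smul, add_comm])
  rw [Module.finrank_eq_card_basis b] at this
  simp at this

/-- With distinct eigenvalues, a nonzero stable subspace contains one of the eigenvectors `b 0`, `b
1`, and `s` supplies the other. -/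
theorem HasStdBasis.isIrreducible (h : HasStdBasis ρ ζ) (hz : ζ ^ 2 ≠ 1) : ρ.IsIrreducible := by
  obtain ⟨b, hb⟩ := h
  have hd : (ζ : ZMod p) - ((ζ⁻¹ : (ZMod p)ˣ) : ZMod p) ≠ 0 := by
    intro h0
    apply hz
    rw [sq, ← eq_inv_iff_mul_eq_one]
    exact Units.ext (sub_eq_zero.1 h0)
  have hnt : Nontrivial (Subrepresentation ρ) := by
    refine ⟨⊥, ⊤, fun h => ?_⟩
    have h' : (⊥ : Submodule (ZMod p) V) = ⊤ := congrArg Subrepresentation.toSubmodule h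
    apply b.ne_zero 0
    rw [← Submodule.mem_bot (ZMod p), h']
    exact Submodule.mem_top
  refine { toNontrivial := hnt, eq_bot_or_eq_top := fun U => ?_ }
  by_cases hU : U.toSubmodule = ⊥
  · exact Or.inl (Subrepresentation.toSubmodule_injective hU)
  refine Or.inr (Subrepresentation.toSubmodule_injective ?_)
  obtain ⟨w, hw, hw0⟩ := Submodule.exists_mem_ne_zero_of_ne_bot hU
  have both : b 0 ∈ U.toSubmodule ∨ b 1 ∈ U.toSubmodule → U.toSubmodule = ⊤ := by
    intro hor
    have h01 : b 0 ∈ U.toSubmodule ∧ b 1 ∈ U.toSubmodule := by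
      rcases hor with h0 | h1
      · exact ⟨h0, by rw [← hb.s_zero]; exact U.apply_mem_toSubmodule _ h0⟩
      · exact ⟨by rw [← hb.s_one]; exact U.apply_mem_toSubmodule _ h1, h1⟩
    rw [eq_top_iff]
    intro x _
    rw [basis_eq_add b x]
    exact add_mem (Submodule.smul_mem _ _ h01.1) (Submodule.smul_mem _ _ h01.2)
  apply both
  have hrw := U.apply_mem_toSubmodule (DihedralGroup.r 1) hw
  rw [hb.r_apply] at hrw
  by_cases hx : b.repr w 0 = 0
  · right
    have hy : b.repr w 1 ≠ 0 := by
      intro hy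
      apply hw0
      rw [basis_eq_add b w, hx, hy]; simp
    rw [basis_eq_add b w, hx, zero_smul, zero_add] at hw
    exact (Submodule.smul_mem_iff _ hy).1 hw
  · left
    -- Applying `r - ζ⁻¹` to `w` removes its `b 1` component.
    have h1 := sub_mem hrw (Submodule.smul_mem _ (((ζ⁻¹ : (ZMod p)ˣ) : ZMod p)) hw)
    have e : (ζ * b.repr w 0) • b 0 + (((ζ⁻¹ : (ZMod p)ˣ) : ZMod p) * b.repr w 1) • b 1 -
        ((ζ⁻¹ : (ZMod p)ˣ) : ZMod p) • w =
        (((ζ : ZMod p) - ((ζ⁻¹ : (ZMod p)ˣ) : ZMod p)) * b.repr w 0) • b 0 := by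
      conv_lhs => rw [basis_eq_add b w]
      simp only [map_add, map_smul, Finsupp.add_apply, Finsupp.smul_apply, b.repr_self,
        smul_eq_mul, Finsupp.single_apply, if_true, if_false, Fin.reduceEq, mul_one, mul_zero,
        add_zero, zero_add]
      module
    rw [e] at h1
    exact (Submodule.smul_mem_iff _ (mul_ne_zero hd hx)).1 h1

/-- An operator annihilating a nonzero vector through a product of linear factors has one of the
roots as eigenvalue. -/
theorem exists_eigenvector_of_prod (T : Module.End (ZMod p) V) (s : Multiset (ZMod p)) {v : V}
    (hv : v ≠ 0)
    (h : Polynomial.aeval T (s.map fun a => Polynomial.X - Polynomial.C a).prod v = 0) :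
    ∃ a ∈ s, ∃ w, w ≠ 0 ∧ T w = a • w := by
  induction s using Multiset.induction_on with
  | empty => simp at h; exact absurd h hv
  | cons a s ih =>
    rw [Multiset.map_cons, Multiset.prod_cons, map_mul, Module.End.mul_apply] at h
    by_cases h0 : Polynomial.aeval T (s.map fun a => Polynomial.X - Polynomial.C a).prod v = 0
    · obtain ⟨c, hc, w⟩ := ih h0
      exact ⟨c, Multiset.mem_cons_of_mem hc, w⟩
    · refine ⟨a, Multiset.mem_cons_self a s, _, h0, ?_⟩
      simpa [sub_eq_zero, Algebra.algebraMap_eq_smul_one] using h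

/-- As `p ≡ 1 [MOD n]`, the action of `r` is annihilated by `X ^ p - X`, which splits over `𝔽_p`. No
finiteness of `V` is required. -/
theorem exists_r_eigenvector (hp : p ≡ 1 [MOD n]) {v : V} (hv : v ≠ 0) :
    ∃ η : (ZMod p)ˣ, ∃ w : V, w ≠ 0 ∧ ρ (DihedralGroup.r 1) w = (η : ZMod p) • w := by
  have hpow : ρ (DihedralGroup.r 1) ^ p = ρ (DihedralGroup.r 1) := by
    rw [← map_pow, DihedralGroup.r_one_pow, (ZMod.natCast_eq_natCast_iff _ _ _).2 hp, Nat.cast_one]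
  have hsplit : (Polynomial.X ^ p - Polynomial.X : Polynomial (ZMod p)).Splits := by
    have := FiniteField.splits_X_pow_card_sub_X (K := ZMod p) p
    rwa [Algebra.algebraMap_self, Polynomial.map_id, ZMod.card] at this
  obtain ⟨a, -, w, hw, hrw⟩ := exists_eigenvector_of_prod (ρ (DihedralGroup.r 1))
    (Polynomial.X ^ p - Polynomial.X : Polynomial (ZMod p)).roots hv (by
      rw [← hsplit.eq_prod_roots_of_monic (Polynomial.monic_X_pow_sub (by
        rw [Polynomial.degree_X]
        exact_mod_cast (Fact.out : p.Prime).one_lt))]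
      simp [hpow])
  have ha : a ≠ 0 := by
    rintro rfl
    rw [zero_smul] at hrw
    apply hw
    have := congrArg (ρ (DihedralGroup.r 1)⁻¹) hrw
    rwa [map_zero, ← Module.End.mul_apply, ← map_mul, inv_mul_cancel, map_one,
      Module.End.one_apply] at this
  exact ⟨Units.mk0 a ha, w, hw, hrw⟩

/-- Irreducible representations of the dihedral group are either standard or one-dimensional. -/
theorem exists_hasStdBasis_or_finrank_eq_one (hp : p ≡ 1 [MOD n]) (hρ : ρ.IsIrreducible) :
    (∃ ζ, HasStdBasis ρ ζ) ∨ Module.finrank (ZMod p) V = 1 := by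
  obtain ⟨v, hv⟩ := exists_ne_zero_of_irreducible hρ
  obtain ⟨η, w, hw, hrw⟩ := exists_r_eigenvector (ρ := ρ) hp hv
  set w' := ρ (DihedralGroup.sr 0) w with hw'
  have hsw' : ρ (DihedralGroup.sr 0) w' = w := map_sr_map_sr w
  have hrw' : ρ (DihedralGroup.r 1) w' = ((η⁻¹ : (ZMod p)ˣ) : ZMod p) • w' := by
    have := map_sr_map_r (σ := ρ) w
    rw [hrw, map_smul, map_smul, ← hw'] at this
    rw [← this, smul_smul, Units.inv_mul, one_smul, this]
  -- If the eigenvalues of `w` and `s w` coincide, then `w + s w`, or `w` itself when that sum is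
  -- zero, spans a stable line. Otherwise `w` and `s w` form a standard basis.
  by_cases hη : (η : ZMod p) = ((η⁻¹ : (ZMod p)ˣ) : ZMod p)
  · right
    rw [← hη] at hrw'
    by_cases h0 : w + w' = 0
    · refine finrank_eq_one_of_stable (c := -1) hρ hw hrw ?_
      rw [← hw', eq_neg_of_add_eq_zero_right h0, neg_smul, one_smul]
    · refine finrank_eq_one_of_stable (c := 1) hρ h0 (a := η) ?_ ?_
      · rw [map_add, hrw, hrw', smul_add]
      · rw [map_add, hsw', ← hw', one_smul, add_comm]
  · left
    have hw'0 : w' ≠ 0 := by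
      intro h0
      rw [h0, map_zero] at hsw'
      exact hw hsw'.symm
    have hind : LinearIndependent (ZMod p) ![w, w'] := by
      rw [LinearIndependent.pair_iff]
      intro s t hst
      have h1 := congrArg (ρ (DihedralGroup.r 1)) hst
      rw [map_add, map_smul, map_smul, hrw, hrw', map_zero] at h1
      have h2 : (t * ((η⁻¹ : (ZMod p)ˣ) - (η : ZMod p))) • w' = 0 := by
        linear_combination (norm := module) h1 - (η : ZMod p) • hst
      have ht : t = 0 := by
        have := (smul_eq_zero.1 h2).resolve_right hw'0
        exact (mul_eq_zero.1 this).resolve_right (sub_ne_zero.2 (Ne.symm hη))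
      rw [ht, zero_smul, add_zero] at hst
      exact ⟨(smul_eq_zero.1 hst).resolve_right hw, ht⟩
    have hspan : Submodule.span (ZMod p) (Set.range ![w, w']) = ⊤ := by
      refine eq_top_of_stable (x := w) hρ _ ?_ ?_ (Submodule.subset_span ⟨0, rfl⟩) hw
      · intro x hx
        refine Submodule.span_induction ?_ ?_ ?_ ?_ hx
        · rintro _ ⟨i, rfl⟩
          fin_cases i
          · change ρ _ w ∈ _
            rw [hrw]
            exact Submodule.smul_mem _ _ (Submodule.subset_span ⟨0, rfl⟩)
          · change ρ _ w' ∈ _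
            rw [hrw']
            exact Submodule.smul_mem _ _ (Submodule.subset_span ⟨1, rfl⟩)
        · rw [map_zero]; exact zero_mem _
        · intro x y _ _ hx hy; rw [map_add]; exact add_mem hx hy
        · intro a x _ hx; rw [map_smul]; exact Submodule.smul_mem _ _ hx
      · intro x hx
        refine Submodule.span_induction ?_ ?_ ?_ ?_ hx
        · rintro _ ⟨i, rfl⟩
          fin_cases i
          · change ρ _ w ∈ _
            exact Submodule.subset_span ⟨1, rfl⟩
          · change ρ _ w' ∈ _
            rw [hsw']
            exact Submodule.subset_span ⟨0, rfl⟩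
        · rw [map_zero]; exact zero_mem _
        · intro x y _ _ hx hy; rw [map_add]; exact add_mem hx hy
        · intro a x _ hx; rw [map_smul]; exact Submodule.smul_mem _ _ hx
    have h0 : Module.Basis.mk hind hspan.ge 0 = w := Module.Basis.mk_apply hind hspan.ge 0
    have h1 : Module.Basis.mk hind hspan.ge 1 = w' := Module.Basis.mk_apply hind hspan.ge 1
    exact ⟨η, Module.Basis.mk hind hspan.ge, ⟨by rw [h0, hrw], by rw [h1, hrw'], by rw [h0, h1],
      by rw [h0, h1, hsw']⟩⟩

end StandardBasis

/-! ### Induced representations and the map `T` as squaring of parameters. -/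

section Induced

variable {n p : ℕ} [NeZero n] [Fact p.Prime]

theorem pow_val_add {ζ : (ZMod p)ˣ} (hζ : ζ ^ n = 1) (i j : ZMod n) :
    ζ ^ (i + j).val = ζ ^ i.val * ζ ^ j.val := by
  rw [← pow_add, ZMod.val_add]
  exact (pow_eq_pow_mod _ hζ).symm

/-- The matrices of the standard representation with parameter `ζ`. -/
def stdMatrix (ζ : (ZMod p)ˣ) : DihedralGroup n → Matrix (Fin 2) (Fin 2) (ZMod p)
  | .r i => !![((ζ ^ i.val : (ZMod p)ˣ) : ZMod p), 0; 0, ((ζ ^ (-i).val : (ZMod p)ˣ) : ZMod p)]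
  | .sr i => !![0, ((ζ ^ (-i).val : (ZMod p)ˣ) : ZMod p); ((ζ ^ i.val : (ZMod p)ˣ) : ZMod p), 0]

theorem stdMatrix_one (ζ : (ZMod p)ˣ) : stdMatrix ζ (1 : DihedralGroup n) = 1 := by
  rw [DihedralGroup.one_def, stdMatrix, Matrix.one_fin_two]
  simp

theorem stdMatrix_mul {ζ : (ZMod p)ˣ} (hζ : ζ ^ n = 1) (g h : DihedralGroup n) :
    stdMatrix ζ (g * h) = stdMatrix ζ g * stdMatrix ζ h := by
  cases g <;> cases h <;>
    simp only [DihedralGroup.r_mul_r, DihedralGroup.r_mul_sr, DihedralGroup.sr_mul_r,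
      DihedralGroup.sr_mul_sr, stdMatrix, Matrix.mul_fin_two, sub_eq_add_neg, neg_add, neg_neg,
      pow_val_add hζ, Units.val_mul, mul_zero, zero_mul, add_zero, zero_add] <;>
    congr 1 <;> simp only [mul_comm]

/-- The standard representation with parameter `ζ`. -/
noncomputable def stdRep {ζ : (ZMod p)ˣ} (hζ : ζ ^ n = 1) : Rep2 n p where
  toFun g := Matrix.toLin' (stdMatrix ζ g)
  map_one' := by rw [stdMatrix_one, Matrix.toLin'_one]; rfl
  map_mul' g h := by rw [stdMatrix_mul hζ, Matrix.toLin'_mul]; rfl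

theorem isStdBasis_of_matrix {φ : Rep2 n p} {ζ : (ZMod p)ˣ}
    (hr : φ (DihedralGroup.r 1) =
      Matrix.toLin' !![(ζ : ZMod p), 0; 0, ((ζ⁻¹ : (ZMod p)ˣ) : ZMod p)])
    (hs : φ (DihedralGroup.sr 0) = Matrix.toLin' !![0, 1; 1, 0]) :
    IsStdBasis φ (Pi.basisFun (ZMod p) (Fin 2)) ζ := by
  generalize hw : ((ζ⁻¹ : (ZMod p)ˣ) : ZMod p) = w at hr
  generalize hz : (ζ : ZMod p) = z at hr
  refine ⟨?_, ?_, ?_, ?_⟩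
  · rw [hr, hz]; ext i; fin_cases i <;> simp
  · rw [hr, hw]; ext i; fin_cases i <;> simp
  · rw [hs]; ext i; fin_cases i <;> simp
  · rw [hs]; ext i; fin_cases i <;> simp

theorem stdRep_r {ζ : (ZMod p)ˣ} (hζ : ζ ^ n = 1) : stdRep hζ (DihedralGroup.r 1) =
    Matrix.toLin' !![(ζ : ZMod p), 0; 0, ((ζ⁻¹ : (ZMod p)ˣ) : ZMod p)] := by
  have h1 : ζ ^ (1 : ZMod n).val = ζ := by
    rw [ZMod.val_one_eq_one_mod, ← pow_eq_pow_mod _ hζ, pow_one]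
  have h2 : ζ ^ (-1 : ZMod n).val = ζ⁻¹ := by
    have := pow_val_add hζ 1 (-1)
    rw [add_neg_cancel, ZMod.val_zero, pow_zero, h1] at this
    exact eq_inv_of_mul_eq_one_right this.symm
  change Matrix.toLin' (stdMatrix ζ _) = _
  rw [stdMatrix, h1, h2]

theorem stdRep_s {ζ : (ZMod p)ˣ} (hζ : ζ ^ n = 1) : stdRep hζ (DihedralGroup.sr 0) =
    Matrix.toLin' !![0, 1; 1, 0] := by
  change Matrix.toLin' (stdMatrix ζ _) = _
  simp [stdMatrix]

theorem isStandardForm_stdRep {ζ : (ZMod p)ˣ} (hζ : ζ ^ n = 1) : IsStandardForm (stdRep hζ) :=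
  ⟨ζ, stdRep_r hζ, stdRep_s hζ⟩

theorem isStdBasis_stdRep {ζ : (ZMod p)ˣ} (hζ : ζ ^ n = 1) :
    IsStdBasis (stdRep hζ) (Pi.basisFun (ZMod p) (Fin 2)) ζ :=
  isStdBasis_of_matrix (stdRep_r hζ) (stdRep_s hζ)

theorem hasStdBasis_stdRep {ζ : (ZMod p)ˣ} (hζ : ζ ^ n = 1) : HasStdBasis (stdRep hζ) ζ :=
  ⟨_, isStdBasis_stdRep hζ⟩

/-- The generator of the rotation subgroup. -/
def rotGen (n : ℕ) : rotations n := ⟨DihedralGroup.r 1, Subgroup.mem_zpowers _⟩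

theorem mem_zpowers_rotGen (x : rotations n) : x ∈ Subgroup.zpowers (rotGen n) := by
  obtain ⟨x, k, rfl⟩ := x
  exact ⟨k, by ext; simp [rotGen]⟩

theorem rotGen_pow : rotGen n ^ n = 1 := by
  ext
  simp [rotGen]

theorem char_pow_eq_one (χ : rotations n →* (ZMod p)ˣ) : χ (rotGen n) ^ n = 1 := by
  rw [← map_pow, rotGen_pow, map_one]

theorem exists_char {ζ : (ZMod p)ˣ} (hζ : ζ ^ n = 1) :
    ∃ χ : rotations n →* (ZMod p)ˣ, χ (rotGen n) = ζ := by
  have ho : orderOf (rotGen n) = n := by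
    rw [← Subgroup.orderOf_coe]
    exact DihedralGroup.orderOf_r_one
  refine ⟨monoidHomOfForallMemZpowers mem_zpowers_rotGen (g' := ζ) ?_,
    monoidHomOfForallMemZpowers_apply_gen _ _⟩
  rw [ho]
  exact orderOf_dvd_of_pow_eq_one hζ

theorem charRep_apply (χ : rotations n →* (ZMod p)ˣ) (x : rotations n) (a : ZMod p) :
    charRep χ x a = (χ x : ZMod p) * a := rfl

theorem indChar_mk (χ : rotations n →* (ZMod p)ˣ) (g h : DihedralGroup n) (a : ZMod p) :
    indChar χ g (Representation.IndV.mk (rotations n).subtype (charRep χ) h a) =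
      Representation.IndV.mk (rotations n).subtype (charRep χ) (h * g⁻¹) a :=
  Representation.ind_mk _ _ _ _ _

theorem indMk_mul (χ : rotations n →* (ZMod p)ˣ) (x : rotations n) (h : DihedralGroup n)
    (a : ZMod p) :
    Representation.IndV.mk (rotations n).subtype (charRep χ) (x * h) ((χ x : ZMod p) * a) =
      Representation.IndV.mk (rotations n).subtype (charRep χ) h a := by
  have := Representation.Coinvariants.mk_self_apply
    (Representation.tprod ((Representation.leftRegular (ZMod p) (DihedralGroup n)).comp
      (rotations n).subtype) (charRep χ)) x (TensorProduct.mk (ZMod p) _ _ (.single h 1) a)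
  refine Eq.trans ?_ this
  simp [charRep_apply]

theorem indMk_r_mul (χ : rotations n →* (ZMod p)ˣ) (h : DihedralGroup n) (a : ZMod p) :
    Representation.IndV.mk (rotations n).subtype (charRep χ) (DihedralGroup.r 1 * h) a =
      (((χ (rotGen n))⁻¹ : (ZMod p)ˣ) : ZMod p) •
        Representation.IndV.mk (rotations n).subtype (charRep χ) h a := by
  have := indMk_mul χ (rotGen n) h (((χ (rotGen n))⁻¹ : (ZMod p)ˣ) * a)
  rw [← mul_assoc, Units.mul_inv, one_mul] at this
  rw [← map_smul, smul_eq_mul]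
  exact this

theorem indMk_one_mem_span (χ : rotations n →* (ZMod p)ˣ) (h : DihedralGroup n) (a : ZMod p) :
    Representation.IndV.mk (rotations n).subtype (charRep χ) h a ∈ Submodule.span (ZMod p)
      (Set.range ![Representation.IndV.mk (rotations n).subtype (charRep χ) 1 1,
        Representation.IndV.mk (rotations n).subtype (charRep χ) (DihedralGroup.sr 0) 1]) := by
  have key : ∀ (h' : DihedralGroup n) (x : rotations n) (a : ZMod p),
      ∃ c : ZMod p, Representation.IndV.mk (rotations n).subtype (charRep χ) (x * h') a =
        c • Representation.IndV.mk (rotations n).subtype (charRep χ) h' 1 := by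
    intro h' x a
    refine ⟨((χ x)⁻¹ : (ZMod p)ˣ) * a, ?_⟩
    have := indMk_mul χ x h' (((χ x)⁻¹ : (ZMod p)ˣ) * a)
    rw [← mul_assoc, Units.mul_inv, one_mul] at this
    rw [← map_smul, smul_eq_mul, mul_one]
    exact this
  have hr : ∀ i : ZMod n, DihedralGroup.r i ∈ rotations n := fun i =>
    ⟨i.val, by simp⟩
  cases h with
  | r i =>
    obtain ⟨c, hc⟩ := key 1 ⟨_, hr i⟩ a
    rw [mul_one] at hc
    rw [hc]
    exact Submodule.smul_mem _ _ (Submodule.subset_span ⟨0, rfl⟩)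
  | sr i =>
    obtain ⟨c, hc⟩ := key (DihedralGroup.sr 0) ⟨_, hr (-i)⟩ a
    rw [DihedralGroup.r_mul_sr, sub_neg_eq_add, zero_add] at hc
    rw [hc]
    exact Submodule.smul_mem _ _ (Submodule.subset_span ⟨1, rfl⟩)

/-- Frobenius reciprocity: the map from the induced representation to the standard one. -/
theorem exists_indChar_map (χ : rotations n →* (ZMod p)ˣ) :
    ∃ F : (indChar χ).IntertwiningMap (stdRep (char_pow_eq_one χ)),
      F (Representation.IndV.mk (rotations n).subtype (charRep χ) 1 1) =
        Pi.basisFun (ZMod p) (Fin 2) 0 := by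
  let τ := stdRep (char_pow_eq_one χ)
  have hb := isStdBasis_stdRep (char_pow_eq_one χ)
  have hτ : ∀ x : rotations n, τ x (Pi.basisFun (ZMod p) (Fin 2) 0) =
      (χ x : ZMod p) • Pi.basisFun (ZMod p) (Fin 2) 0 := by
    intro x
    obtain ⟨k, rfl⟩ := (Submonoid.mem_powers_iff _ _).1
      ((mem_powers_iff_mem_zpowers (x := rotGen n)).2 (mem_zpowers_rotGen x))
    induction k with
    | zero => simp
    | succ k ih =>
      rw [pow_succ, map_mul, Subgroup.coe_mul, map_mul, Module.End.mul_apply, Units.val_mul,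
        mul_comm, mul_smul, ← ih, ← map_smul]
      congr 1
      exact hb.r_zero
  let f : (charRep χ).IntertwiningMap (τ.comp (rotations n).subtype) :=
    ⟨LinearMap.toSpanSingleton (ZMod p) _ (Pi.basisFun (ZMod p) (Fin 2) 0), fun x => by
      ext1
      simp only [LinearMap.comp_apply, charRep_apply, LinearMap.toSpanSingleton_apply, one_smul,
        mul_one]
      exact (hτ x).symm⟩
  let F := (Rep.indResHomEquiv (rotations n).subtype (Rep.of (charRep χ)) (Rep.of τ)).symm
    (Rep.ofHom f)
  refine ⟨F.hom, ?_⟩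
  have h := (Rep.indResHomEquiv (rotations n).subtype (Rep.of (charRep χ)) (Rep.of τ)).apply_symm_apply
    (Rep.ofHom f)
  have h' := congrArg (fun q => q.hom (1 : ZMod p)) h
  refine Eq.trans ?_ (h'.trans (one_smul (ZMod p) (Pi.basisFun (ZMod p) (Fin 2) 0)))
  rfl

/-- The basis consists of the classes of the two cosets of `⟨r⟩`. They span by the coinvariant
relations; they are independent because Frobenius reciprocity maps them to a basis of the standard
representation. -/
theorem hasStdBasis_indChar (χ : rotations n →* (ZMod p)ˣ) :
    HasStdBasis (indChar χ) (χ (rotGen n)) := by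
  obtain ⟨F, hF⟩ := exists_indChar_map χ
  have hb := isStdBasis_stdRep (char_pow_eq_one χ)
  set b := Pi.basisFun (ZMod p) (Fin 2) with hbdef
  set e := Representation.IndV.mk (rotations n).subtype (charRep χ) 1 1 with he
  set e' := Representation.IndV.mk (rotations n).subtype (charRep χ) (DihedralGroup.sr 0) 1 with he'
  have hs : indChar χ (DihedralGroup.sr 0) e = e' := by
    rw [he, indChar_mk, one_mul, DihedralGroup.inv_sr]
  have hs' : indChar χ (DihedralGroup.sr 0) e' = e := by
    rw [he', indChar_mk, mul_inv_cancel]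
  have hr : indChar χ (DihedralGroup.r 1) e = (χ (rotGen n) : ZMod p) • e := by
    rw [he, indChar_mk, one_mul]
    have := indMk_r_mul χ (DihedralGroup.r 1)⁻¹ 1
    rw [mul_inv_cancel] at this
    rw [this, smul_smul, Units.mul_inv, one_smul]
  have hr' : indChar χ (DihedralGroup.r 1) e' = (((χ (rotGen n))⁻¹ : (ZMod p)ˣ) : ZMod p) • e' := by
    have h1 := map_sr_map_r (σ := indChar χ) e
    rw [hr, map_smul, map_smul, hs] at h1
    rw [← h1, smul_smul, Units.inv_mul, one_smul, h1]
  have hF' : F e' = b 1 := by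
    rw [← hs, ← hb.s_zero, ← hF]
    exact Representation.IntertwiningMap.isIntertwining _ _ F _ _
  have hind : LinearIndependent (ZMod p) ![e, e'] := by
    apply LinearIndependent.of_comp F.toLinearMap
    have hcomp : F.toLinearMap ∘ ![e, e'] = b := by
      ext1 i
      fin_cases i
      · exact hF
      · exact hF'
    rw [hcomp]
    exact b.linearIndependent
  have hspan : Submodule.span (ZMod p) (Set.range ![e, e']) = ⊤ := by
    rw [← Submodule.ker_mkQ (Submodule.span (ZMod p) (Set.range ![e, e'])), LinearMap.ker_eq_top]
    refine Representation.IndV.hom_ext _ _ fun h => ?_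
    ext1
    simp only [LinearMap.comp_apply, LinearMap.zero_apply]
    exact (Submodule.Quotient.mk_eq_zero _).2 (indMk_one_mem_span χ h 1)
  have h0 : Module.Basis.mk hind hspan.ge 0 = e := Module.Basis.mk_apply hind hspan.ge 0
  have h1 : Module.Basis.mk hind hspan.ge 1 = e' := Module.Basis.mk_apply hind hspan.ge 1
  exact ⟨Module.Basis.mk hind hspan.ge, ⟨by rw [h0, hr], by rw [h1, hr'], by rw [h0, h1, hs],
    by rw [h0, h1, hs']⟩⟩

theorem isT_iff_exists {ψ φ : Rep2 n p} :
    IsT ψ φ ↔ ∃ η : (ZMod p)ˣ, HasStdBasis ψ η ∧ HasStdBasis φ (η ^ 2) := by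
  constructor
  · rintro ⟨χ, ⟨e⟩, ⟨f⟩⟩
    exact ⟨χ (rotGen n), (hasStdBasis_indChar χ).of_equiv e.symm,
      (hasStdBasis_indChar (χ ^ 2)).of_equiv f.symm⟩
  · rintro ⟨η, h1, h2⟩
    obtain ⟨χ, rfl⟩ := exists_char h1.pow_eq_one
    exact ⟨χ, h1.nonempty_equiv (hasStdBasis_indChar χ),
      h2.nonempty_equiv (hasStdBasis_indChar (χ ^ 2))⟩

/-- The ambiguity of parameters is absorbed by passing from `η` to `η⁻¹`; the preimages of `φ` thus
correspond to square roots of one fixed `ζ`. -/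
theorem isT_iff {ψ φ : Rep2 n p} {ζ : (ZMod p)ˣ} (hφ : HasStdBasis φ ζ) :
    IsT ψ φ ↔ ∃ η : (ZMod p)ˣ, HasStdBasis ψ η ∧ η ^ 2 = ζ := by
  rw [isT_iff_exists]
  constructor
  · rintro ⟨η, h1, h2⟩
    rcases hφ.eq_or_eq_inv h2 with h | h
    · exact ⟨η, h1, h⟩
    · exact ⟨η⁻¹, h1.inv, by rw [inv_pow, h, inv_inv]⟩
  · rintro ⟨η, h1, rfl⟩
    exact ⟨η, h1, hφ⟩

theorem exists_hasStdBasis (hp : p ≡ 1 [MOD n]) {φ : Rep2 n p} (hφ : φ.IsIrreducible) :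
    ∃ ζ, HasStdBasis φ ζ := by
  refine (exists_hasStdBasis_or_finrank_eq_one hp hφ).resolve_right fun h => ?_
  simp at h

end Induced

/-! ### The invariants for `M = End V`. -/

section Endomorphisms

variable {n p : ℕ} [NeZero n] [Fact p.Prime] {V : Type} [AddCommGroup V] [Module (ZMod p) V]
  {ρ : Representation (ZMod p) (DihedralGroup n) V} {ζ η : (ZMod p)ˣ}

theorem comp_eq_of_linHom_eq {g : DihedralGroup n} {f f' : V →ₗ[ZMod p] V}
    (h : ρ.linHom ρ g f = f') : ρ g ∘ₗ f = f' ∘ₗ ρ g := by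
  rw [← h]
  ext x
  simp [← Module.End.mul_apply, ← map_mul]

theorem linHom_eq_of_comp_eq {g : DihedralGroup n} {f f' : V →ₗ[ZMod p] V}
    (h : ρ g ∘ₗ f = f' ∘ₗ ρ g) : ρ.linHom ρ g f = f' := by
  rw [Representation.linHom_apply, ← LinearMap.comp_assoc, h]
  ext x
  simp [← Module.End.mul_apply, ← map_mul]

/-- Membership in the space of invariants of `End V`, in matrix entries. -/
theorem entries_of_mem_invariantPairs {c : Module.Basis (Fin 2) (ZMod p) V}
    (hc : IsStdBasis ρ c η) {q : (V →ₗ[ZMod p] V) × (V →ₗ[ZMod p] V)}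
    (hq : q ∈ invariantPairs (ρ.linHom ρ) ζ) :
    ((ζ : ZMod p) - 1) * c.repr (q.1 (c 0)) 0 = 0 ∧
    ((ζ : ZMod p) - 1) * c.repr (q.1 (c 1)) 1 = 0 ∧
    ((η : ZMod p) ^ 2 - ζ) * c.repr (q.1 (c 1)) 0 = 0 ∧
    ((ζ : ZMod p) * η ^ 2 - 1) * c.repr (q.1 (c 0)) 1 = 0 ∧
    ((η : ZMod p) ^ 2 - 1) * c.repr (q.2 (c 1)) 0 = 0 ∧
    ((η : ZMod p) ^ 2 - 1) * c.repr (q.2 (c 0)) 1 = 0 ∧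
    c.repr (q.2 (c 1)) 1 = - c.repr (q.2 (c 0)) 0 := by
  obtain ⟨hu, hv, hs⟩ := mem_invariantPairs.1 hq
  have hu := comp_eq_of_linHom_eq hu
  have hv := comp_eq_of_linHom_eq hv
  have hs := comp_eq_of_linHom_eq hs
  have e : (η : ZMod p) * ((η⁻¹ : (ZMod p)ˣ) : ZMod p) = 1 := Units.mul_inv η
  have u00 := congrArg (fun x => c.repr x 0) (LinearMap.congr_fun hu (c 0))
  have u01 := congrArg (fun x => c.repr x 1) (LinearMap.congr_fun hu (c 0))
  have u10 := congrArg (fun x => c.repr x 0) (LinearMap.congr_fun hu (c 1))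
  have u11 := congrArg (fun x => c.repr x 1) (LinearMap.congr_fun hu (c 1))
  have v01 := congrArg (fun x => c.repr x 1) (LinearMap.congr_fun hv (c 0))
  have v10 := congrArg (fun x => c.repr x 0) (LinearMap.congr_fun hv (c 1))
  have s0 := congrArg (fun x => c.repr x 1) (LinearMap.congr_fun hs (c 0))
  simp only [LinearMap.comp_apply, hc.repr_r_zero, hc.repr_r_one, hc.r_zero, hc.r_one, map_smul,
    LinearMap.smul_apply, Finsupp.smul_apply, smul_eq_mul, hc.repr_s_one, hc.s_zero,
    LinearMap.neg_apply, map_neg, Finsupp.neg_apply] at u00 u01 u10 u11 v01 v10 s0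
  generalize ((η⁻¹ : (ZMod p)ˣ) : ZMod p) = w at *
  refine ⟨?_, ?_, ?_, ?_, ?_, ?_, ?_⟩
  · linear_combination (-w) * u00 + (1 - ζ) * c.repr (q.1 (c 0)) 0 * e
  · linear_combination (-η : ZMod p) * u11 + (1 - ζ) * c.repr (q.1 (c 1)) 1 * e
  · linear_combination (η : ZMod p) * u10 + ζ * c.repr (q.1 (c 1)) 0 * e
  · linear_combination (-η : ZMod p) * u01 + c.repr (q.1 (c 0)) 1 * e
  · linear_combination (η : ZMod p) * v10 + c.repr (q.2 (c 1)) 0 * e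
  · linear_combination (-η : ZMod p) * v01 + c.repr (q.2 (c 0)) 1 * e
  · linear_combination s0

theorem eq_zero_of_entries {c : Module.Basis (Fin 2) (ZMod p) V} {f : V →ₗ[ZMod p] V}
    (h00 : c.repr (f (c 0)) 0 = 0) (h01 : c.repr (f (c 0)) 1 = 0)
    (h10 : c.repr (f (c 1)) 0 = 0) (h11 : c.repr (f (c 1)) 1 = 0) : f = 0 := by
  refine c.ext fun i => ?_
  fin_cases i
  · change f (c 0) = 0
    rw [basis_eq_add c (f (c 0)), h00, h01]; simp
  · change f (c 1) = 0
    rw [basis_eq_add c (f (c 1)), h10, h11]; simp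

/-- The coordinate `f ↦ f_{ij}` on endomorphisms. -/
noncomputable def entry (c : Module.Basis (Fin 2) (ZMod p) V) (i j : Fin 2) :
    (V →ₗ[ZMod p] V) →ₗ[ZMod p] ZMod p :=
  c.coord i ∘ₗ LinearMap.applyₗ (c j)

theorem sub_ne_zero_of_sq (hη : η ^ 2 ≠ 1) : (η : ZMod p) ^ 2 - 1 ≠ 0 := by
  intro h
  apply hη
  ext
  push_cast
  exact sub_eq_zero.1 h

/-- Since `ζ ≠ 1`, the first component is off-diagonal. Its two entries need `ζ = η ^ 2` and `ζ =
η⁻¹ ^ 2` respectively, which exclude each other as `ζ ^ 2 ≠ 1`. The second component is a multiple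
of `diag(1, -1)`. -/
theorem finrank_invariantPairs_le_two {c : Module.Basis (Fin 2) (ZMod p) V}
    (hc : IsStdBasis ρ c η) (hη : η ^ 2 ≠ 1) (hζ : ζ ^ 2 ≠ 1) :
    Module.finrank (ZMod p) (invariantPairs (ρ.linHom ρ) ζ) ≤ 2 := by
  have hζ1 : (ζ : ZMod p) - 1 ≠ 0 := by
    intro h
    apply hζ
    have : ζ = 1 := Units.ext (sub_eq_zero.1 h)
    rw [this, one_pow]
  have hη1 := sub_ne_zero_of_sq hη
  -- At most one off-diagonal entry is nonzero, so their sum already detects the first component.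
  let F : invariantPairs (ρ.linHom ρ) ζ →ₗ[ZMod p] ZMod p × ZMod p :=
    LinearMap.prod ((entry c 0 1 + entry c 1 0) ∘ₗ LinearMap.fst _ _ _ ∘ₗ Submodule.subtype _)
      (entry c 0 0 ∘ₗ LinearMap.snd _ _ _ ∘ₗ Submodule.subtype _)
  have hF : ∀ q, F q = (c.repr (q.1.1 (c 1)) 0 + c.repr (q.1.1 (c 0)) 1, c.repr (q.1.2 (c 0)) 0) :=
    fun q => rfl
  have hinj : Function.Injective F := by
    rw [← LinearMap.ker_eq_bot, LinearMap.ker_eq_bot']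
    rintro ⟨q, hq⟩ h
    rw [hF, Prod.mk_eq_zero] at h
    obtain ⟨h1, h2⟩ := h
    obtain ⟨e1, e2, e3, e4, e5, e6, e7⟩ := entries_of_mem_invariantPairs hc hq
    have a1 := (mul_eq_zero.1 e1).resolve_left hζ1
    have a2 := (mul_eq_zero.1 e2).resolve_left hζ1
    have a5 := (mul_eq_zero.1 e5).resolve_left hη1
    have a6 := (mul_eq_zero.1 e6).resolve_left hη1
    rw [h2, neg_zero] at e7
    have a3 : c.repr (q.1 (c 1)) 0 = 0 := by
      by_contra h3
      have h4 : c.repr (q.1 (c 0)) 1 ≠ 0 := by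
        intro h4
        rw [h4, add_zero] at h1
        exact h3 h1
      have z1 := (mul_eq_zero.1 e3).resolve_right h3
      have z2 := (mul_eq_zero.1 e4).resolve_right h4
      apply hζ
      ext
      push_cast
      linear_combination z2 - ζ * z1
    have a4 : c.repr (q.1 (c 0)) 1 = 0 := by
      rw [a3, zero_add] at h1
      exact h1
    ext1
    exact Prod.ext (eq_zero_of_entries a1 a4 a3 a2) (eq_zero_of_entries h2 a6 a5 e7)
  have := LinearMap.finrank_le_finrank_of_injective hinj
  simpa using this

theorem finrank_invariantPairs_le_one {c : Module.Basis (Fin 2) (ZMod p) V}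
    (hc : IsStdBasis ρ c η) (hη : η ^ 2 ≠ 1) (hζ : ζ ^ 2 ≠ 1) (h1 : η ^ 2 ≠ ζ)
    (h2 : ζ * η ^ 2 ≠ 1) :
    Module.finrank (ZMod p) (invariantPairs (ρ.linHom ρ) ζ) ≤ 1 := by
  have hζ1 : (ζ : ZMod p) - 1 ≠ 0 := by
    intro h
    apply hζ
    have : ζ = 1 := Units.ext (sub_eq_zero.1 h)
    rw [this, one_pow]
  have hη1 := sub_ne_zero_of_sq hη
  have hz1 : (η : ZMod p) ^ 2 - ζ ≠ 0 := by
    intro h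
    apply h1
    ext
    push_cast
    exact sub_eq_zero.1 h
  have hz2 : (ζ : ZMod p) * η ^ 2 - 1 ≠ 0 := by
    intro h
    apply h2
    ext
    push_cast
    exact sub_eq_zero.1 h
  let F : invariantPairs (ρ.linHom ρ) ζ →ₗ[ZMod p] ZMod p :=
    entry c 0 0 ∘ₗ LinearMap.snd _ _ _ ∘ₗ Submodule.subtype _
  have hF : ∀ q, F q = c.repr (q.1.2 (c 0)) 0 := fun q => rfl
  have hinj : Function.Injective F := by
    rw [← LinearMap.ker_eq_bot, LinearMap.ker_eq_bot']
    rintro ⟨q, hq⟩ h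
    rw [hF] at h
    obtain ⟨e1, e2, e3, e4, e5, e6, e7⟩ := entries_of_mem_invariantPairs hc hq
    rw [h, neg_zero] at e7
    ext1
    exact Prod.ext (eq_zero_of_entries ((mul_eq_zero.1 e1).resolve_left hζ1)
      ((mul_eq_zero.1 e4).resolve_left hz2) ((mul_eq_zero.1 e3).resolve_left hz1)
      ((mul_eq_zero.1 e2).resolve_left hζ1)) (eq_zero_of_entries h
      ((mul_eq_zero.1 e6).resolve_left hη1) ((mul_eq_zero.1 e5).resolve_left hη1) e7)
  have := LinearMap.finrank_le_finrank_of_injective hinj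
  simpa using this

theorem two_le_finrank_invariantPairs {c : Module.Basis (Fin 2) (ZMod p) V}
    (hc : IsStdBasis ρ c η) (h : η ^ 2 = ζ) :
    2 ≤ Module.finrank (ZMod p) (invariantPairs (ρ.linHom ρ) ζ) := by
  have : Module.Finite (ZMod p) V := Module.Finite.of_basis c
  let u : V →ₗ[ZMod p] V := c.constr (ZMod p) ![0, c 0]
  let v : V →ₗ[ZMod p] V := c.constr (ZMod p) ![c 0, -c 1]
  have u0 : u (c 0) = 0 := c.constr_basis _ _ 0
  have u1 : u (c 1) = c 0 := c.constr_basis _ _ 1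
  have v0 : v (c 0) = c 0 := c.constr_basis _ _ 0
  have v1 : v (c 1) = -c 1 := c.constr_basis _ _ 1
  have hu : ρ.linHom ρ (DihedralGroup.r 1) u = (ζ : ZMod p) • u := by
    refine linHom_eq_of_comp_eq (c.ext fun i => ?_)
    fin_cases i
    · change ρ _ (u (c 0)) = (ζ : ZMod p) • u (ρ _ (c 0))
      rw [u0, hc.r_zero, map_smul, u0]; simp
    · change ρ _ (u (c 1)) = (ζ : ZMod p) • u (ρ _ (c 1))
      rw [u1, hc.r_zero, hc.r_one, map_smul, u1, smul_smul, ← h, sq, ← Units.val_mul,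
        mul_inv_cancel_right]
  have hv : ρ.linHom ρ (DihedralGroup.r 1) v = v := by
    refine linHom_eq_of_comp_eq (c.ext fun i => ?_)
    fin_cases i
    · change ρ _ (v (c 0)) = v (ρ _ (c 0))
      rw [v0, hc.r_zero, map_smul, v0]
    · change ρ _ (v (c 1)) = v (ρ _ (c 1))
      rw [v1, map_neg, hc.r_one, map_smul, v1, smul_neg]
  have hs : ρ.linHom ρ (DihedralGroup.sr 0) v = -v := by
    refine linHom_eq_of_comp_eq (c.ext fun i => ?_)
    fin_cases i
    · change ρ _ (v (c 0)) = -v (ρ _ (c 0))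
      rw [v0, hc.s_zero, v1, neg_neg]
    · change ρ _ (v (c 1)) = -v (ρ _ (c 1))
      rw [v1, map_neg, hc.s_one, v0]
  let q : Fin 2 → invariantPairs (ρ.linHom ρ) ζ := ![
    ⟨(u, 0), mem_invariantPairs.2 ⟨hu, by simp, by simp⟩⟩,
    ⟨(0, v), mem_invariantPairs.2 ⟨by simp, hv, hs⟩⟩]
  have hq : LinearIndependent (ZMod p) q := by
    rw [LinearIndependent.pair_iff]
    intro a b hab
    have hab' : a • ((u, 0) : (V →ₗ[ZMod p] V) × (V →ₗ[ZMod p] V)) + b • (0, v) = 0 :=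
      congrArg Subtype.val hab
    have ha : a • u = 0 := by simpa using congrArg Prod.fst hab'
    have hb : b • v = 0 := by simpa using congrArg Prod.snd hab'
    constructor
    · have := LinearMap.congr_fun ha (c 1)
      rw [LinearMap.smul_apply, u1] at this
      exact (smul_eq_zero.1 this).resolve_right (c.ne_zero 0)
    · have := LinearMap.congr_fun hb (c 0)
      rw [LinearMap.smul_apply, v0] at this
      exact (smul_eq_zero.1 this).resolve_right (c.ne_zero 0)
  simpa using hq.fintype_card_le_finrank

/-- Endomorphisms of a line are scalars, on which `G` acts trivially, while `ζ ≠ 1` and `-1 ≠ 1`. -/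
theorem finrank_invariantPairs_eq_zero (hV : Module.finrank (ZMod p) V = 1) (hp2 : p ≠ 2)
    (hζ : ζ ^ 2 ≠ 1) : Module.finrank (ZMod p) (invariantPairs (ρ.linHom ρ) ζ) = 0 := by
  have htriv : ∀ g f, ρ.linHom ρ g f = f := by
    intro g f
    refine linHom_eq_of_comp_eq ?_
    obtain ⟨a, ha, -⟩ := LinearMap.existsUnique_eq_smul_id_of_finrank_eq_one hV f
    rw [ha]
    ext x
    simp
  have : invariantPairs (ρ.linHom ρ) ζ = ⊥ := by
    rw [eq_bot_iff]
    intro q hq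
    obtain ⟨hu, hv, hs⟩ := mem_invariantPairs.1 hq
    rw [htriv] at hu hs
    refine Prod.ext ?_ ?_
    · have h1 : (1 - (ζ : ZMod p)) • q.1 = 0 := by rw [sub_smul, one_smul, ← hu, sub_self]
      refine (smul_eq_zero.1 h1).resolve_left fun h => hζ ?_
      have : ζ = 1 := Units.ext (sub_eq_zero.1 h).symm
      rw [this, one_pow]
    · apply eq_zero_of_two_nsmul hp2
      nth_rw 1 [hs]
      rw [neg_add_cancel]
  rw [this, finrank_bot]

end Endomorphisms

/-! ### Cohomological maximality. -/

section Maximality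

variable {n p : ℕ} [NeZero n] [Fact p.Prime] {Γ : Type} [Group Γ]
  {S : GroupExtension (Multiplicative (Fin 2 → ZMod p)) Γ (DihedralGroup n)} {φ ψ ψ₀ : Rep2 n p}

/-- If `φ` has a preimage under `T`, its preimages are the cohomologically maximal
representations. -/
theorem isCohomologicallyMaximal_iff_isT (hp : p ≡ 1 [MOD n]) (hp2 : p ≠ 2) (hpn : p.Coprime n)
    (hφ : φ.IsIrreducible) (hS : ActsBy S φ) (hψ₀ : ψ₀.IsIrreducible) (hT : IsT ψ₀ φ)
    (hψ : ψ.IsIrreducible) : IsCohomologicallyMaximal S.rightHom ψ ↔ IsT ψ φ := by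
  obtain ⟨ζ, hζ⟩ := exists_hasStdBasis hp hφ
  have hζ2 := hζ.sq_ne_one hφ
  have hd2 : ∀ (V : Type) [AddCommGroup V] [Module (ZMod p) V]
      (ρ : Representation (ZMod p) (DihedralGroup n) V),
      d2 S.rightHom ρ = Module.finrank (ZMod p) (invariantPairs (ρ.linHom ρ) ζ) := by
    intro V _ _ ρ
    obtain ⟨b, hb⟩ := hζ
    exact finrank_cohomology_eq hp2 hpn hS hb
  have hT2 : ∀ ρ : Rep2 n p, IsT ρ φ → 2 ≤ d2 S.rightHom ρ := by
    intro ρ h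
    obtain ⟨η, ⟨c, hc⟩, h⟩ := (isT_iff hζ).1 h
    rw [hd2]
    exact two_le_finrank_invariantPairs hc h
  constructor
  · intro hmax
    by_contra hnot
    obtain ⟨η, hη⟩ := exists_hasStdBasis hp hψ
    have hη2 := hη.sq_ne_one hψ
    have h1 : η ^ 2 ≠ ζ := fun h => hnot ((isT_iff hζ).2 ⟨η, hη, h⟩)
    -- `ψ` also has parameter `η⁻¹`, so `η ^ 2 = ζ⁻¹` would again make it a preimage of `φ`.
    have h2 : ζ * η ^ 2 ≠ 1 := fun h => hnot ((isT_iff hζ).2 ⟨η⁻¹, hη.inv, by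
      rw [inv_pow]; exact inv_eq_of_mul_eq_one_left h⟩)
    have hle := (hT2 ψ₀ hT).trans (hmax _ ψ₀ hψ₀)
    obtain ⟨c, hc⟩ := hη
    rw [hd2] at hle
    have := finrank_invariantPairs_le_one hc hη2 hζ2 h1 h2
    omega
  · intro h V _ _ ρ hρ
    refine le_trans ?_ (hT2 ψ h)
    rw [hd2]
    rcases exists_hasStdBasis_or_finrank_eq_one hp hρ with ⟨η, hη⟩ | h1
    · have hη2 := hη.sq_ne_one hρ
      obtain ⟨c, hc⟩ := hη
      exact finrank_invariantPairs_le_two hc hη2 hζ2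
    · rw [finrank_invariantPairs_eq_zero h1 hp2 hζ2]
      exact Nat.zero_le _

end Maximality

/-! ### Kernels and fusion orbits in terms of the order of the parameter. -/

section KernelsAndOrbits

variable {n p : ℕ} [NeZero n] [Fact p.Prime] {V : Type} [AddCommGroup V] [Module (ZMod p) V]
  {ρ : Representation (ZMod p) (DihedralGroup n) V} {ζ η : (ZMod p)ˣ}

theorem IsStdBasis.r_pow_zero {b : Module.Basis (Fin 2) (ZMod p) V} (h : IsStdBasis ρ b ζ)
    (k : ℕ) : ρ (DihedralGroup.r 1 ^ k) (b 0) = ((ζ ^ k : (ZMod p)ˣ) : ZMod p) • b 0 := by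
  induction k with
  | zero => simp
  | succ k ih =>
    rw [pow_succ, map_mul, Module.End.mul_apply, h.r_zero, map_smul, ih, smul_smul, pow_succ',
      Units.val_mul]

theorem IsStdBasis.r_pow_one {b : Module.Basis (Fin 2) (ZMod p) V} (h : IsStdBasis ρ b ζ)
    (k : ℕ) : ρ (DihedralGroup.r 1 ^ k) (b 1) = ((ζ⁻¹ ^ k : (ZMod p)ˣ) : ZMod p) • b 1 := by
  induction k with
  | zero => simp
  | succ k ih =>
    rw [pow_succ, map_mul, Module.End.mul_apply, h.r_one, map_smul, ih, smul_smul, pow_succ',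
      Units.val_mul]

theorem r_eq_pow (i : ZMod n) : DihedralGroup.r i = DihedralGroup.r 1 ^ i.val := by simp

theorem IsStdBasis.sr_zero {b : Module.Basis (Fin 2) (ZMod p) V} (h : IsStdBasis ρ b ζ)
    (i : ZMod n) : ρ (DihedralGroup.sr i) (b 0) = ((ζ ^ i.val : (ZMod p)ˣ) : ZMod p) • b 1 := by
  have : DihedralGroup.sr i = DihedralGroup.sr 0 * DihedralGroup.r 1 ^ i.val := by
    rw [← r_eq_pow, DihedralGroup.sr_mul_r, zero_add]
  rw [this, map_mul, Module.End.mul_apply, h.r_pow_zero, map_smul, h.s_zero]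

theorem smul_basis_one_ne (b : Module.Basis (Fin 2) (ZMod p) V) (a : (ZMod p)ˣ) (c : ZMod p) :
    (a : ZMod p) • b 1 ≠ c • b 0 := by
  intro h
  have := congrArg (fun x => b.repr x 1) h
  simp only [map_smul, Finsupp.smul_apply, b.repr_self, smul_eq_mul, Finsupp.single_apply,
    if_true, if_false, Fin.reduceEq, mul_one, mul_zero] at this
  exact a.ne_zero this

theorem smul_basis_zero_inj (b : Module.Basis (Fin 2) (ZMod p) V) {a c : (ZMod p)ˣ}
    (h : (a : ZMod p) • b 0 = (c : ZMod p) • b 0) : a = c :=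
  Units.ext (smul_left_injective (ZMod p) (b.ne_zero 0) h)

theorem IsStdBasis.exists_pow_of_apply {b : Module.Basis (Fin 2) (ZMod p) V}
    (h : IsStdBasis ρ b ζ) {g : DihedralGroup n} {a : (ZMod p)ˣ}
    (hg : ρ g (b 0) = (a : ZMod p) • b 0) : ∃ i : ZMod n, g = DihedralGroup.r i ∧ a = ζ ^ i.val := by
  cases g with
  | r i =>
    rw [r_eq_pow, h.r_pow_zero] at hg
    exact ⟨i, rfl, (smul_basis_zero_inj b hg).symm⟩
  | sr i =>
    rw [h.sr_zero] at hg
    exact absurd hg (smul_basis_one_ne b _ _)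

theorem HasStdBasis.mem_ker_iff (h : HasStdBasis ρ ζ) (g : DihedralGroup n) :
    g ∈ MonoidHom.ker ρ ↔ ∃ k : ℕ, g = DihedralGroup.r 1 ^ k ∧ ζ ^ k = 1 := by
  obtain ⟨b, hb⟩ := h
  rw [MonoidHom.mem_ker]
  constructor
  · intro hg
    obtain ⟨i, rfl, hi⟩ := hb.exists_pow_of_apply (g := g) (a := 1) (by
      rw [hg, Module.End.one_apply, Units.val_one, one_smul])
    exact ⟨i.val, r_eq_pow i, hi.symm⟩
  · rintro ⟨k, rfl, hk⟩
    refine b.ext fun i => ?_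
    fin_cases i
    · change ρ _ (b 0) = b 0
      rw [hb.r_pow_zero, hk, Units.val_one, one_smul]
    · change ρ _ (b 1) = b 1
      rw [hb.r_pow_one, inv_pow, hk, inv_one, Units.val_one, one_smul]

theorem HasStdBasis.r_pow_mem_ker_iff (h : HasStdBasis ρ ζ) (k : ℕ) :
    DihedralGroup.r 1 ^ k ∈ MonoidHom.ker ρ ↔ ζ ^ k = 1 := by
  refine ⟨fun hk => ?_, fun hk => (h.mem_ker_iff _).2 ⟨k, rfl, hk⟩⟩
  obtain ⟨b, hb⟩ := h
  have := hb.r_pow_zero k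
  rw [MonoidHom.mem_ker.1 hk, Module.End.one_apply] at this
  exact smul_basis_zero_inj b (by rw [← this, Units.val_one, one_smul])

/-- The kernel consists of the `r ^ k` with `ζ ^ k = 1`, and the set of such `k` amounts to the
order of `ζ`. -/
theorem ker_eq_iff_orderOf_eq {W : Type} [AddCommGroup W] [Module (ZMod p) W]
    {τ : Representation (ZMod p) (DihedralGroup n) W} (h : HasStdBasis ρ ζ)
    (h' : HasStdBasis τ η) : MonoidHom.ker ρ = MonoidHom.ker τ ↔ orderOf ζ = orderOf η := by
  rw [orderOf_eq_orderOf_iff]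
  constructor
  · intro hk k
    rw [← h.r_pow_mem_ker_iff, ← h'.r_pow_mem_ker_iff, hk]
  · intro hk
    ext g
    simp only [h.mem_ker_iff, h'.mem_ker_iff, hk]

theorem range_subset_of_mem_zpowers {τ : Representation (ZMod p) (DihedralGroup n) V}
    {b : Module.Basis (Fin 2) (ZMod p) V} (h : IsStdBasis ρ b ζ) (h' : IsStdBasis τ b η)
    (hz : ζ ∈ Subgroup.zpowers η) (g : DihedralGroup n) : ∃ g', ρ g = τ g' := by
  induction g using dihedral_induction with
  | hmul g g' ih ih' =>
    obtain ⟨a, ha⟩ := ih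
    obtain ⟨c, hc⟩ := ih'
    exact ⟨a * c, by rw [map_mul, map_mul, ha, hc]⟩
  | hr =>
    obtain ⟨k, rfl⟩ := (Submonoid.mem_powers_iff _ _).1 (mem_powers_iff_mem_zpowers.2 hz)
    refine ⟨DihedralGroup.r 1 ^ k, b.ext fun i => ?_⟩
    fin_cases i
    · change ρ _ (b 0) = τ _ (b 0)
      rw [h.r_zero, h'.r_pow_zero]
    · change ρ _ (b 1) = τ _ (b 1)
      rw [h.r_one, h'.r_pow_one, inv_pow]
  | hs =>
    refine ⟨DihedralGroup.sr 0, b.ext fun i => ?_⟩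
    fin_cases i
    · change ρ _ (b 0) = τ _ (b 0)
      rw [h.s_zero, h'.s_zero]
    · change ρ _ (b 1) = τ _ (b 1)
      rw [h.s_one, h'.s_one]

/-- The orbit of `b 0` meets the line through `b 0` exactly in the multiples by `⟨ζ⟩`, so the orbits
recover this group. Conversely, equal groups give the same set of operators on `V`. -/
theorem fusionOrbits_eq_iff {τ : Representation (ZMod p) (DihedralGroup n) V}
    {b : Module.Basis (Fin 2) (ZMod p) V} (h : IsStdBasis ρ b ζ) (h' : IsStdBasis τ b η) :
    fusionOrbits ρ = fusionOrbits τ ↔ Subgroup.zpowers ζ = Subgroup.zpowers η := by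
  constructor
  · have key : ∀ {ρ τ : Representation (ZMod p) (DihedralGroup n) V} {ζ η : (ZMod p)ˣ},
        IsStdBasis ρ b ζ → IsStdBasis τ b η → fusionOrbits ρ = fusionOrbits τ →
        Subgroup.zpowers ζ ≤ Subgroup.zpowers η := by
      intro ρ τ ζ η h h' ho
      rw [Subgroup.zpowers_le]
      have hmem : (Set.range fun g => ρ g (b 0)) ∈ fusionOrbits τ := ho ▸ ⟨b 0, rfl⟩
      obtain ⟨x, hx⟩ := hmem
      have hx : (Set.range fun g => τ g x) = Set.range fun g => ρ g (b 0) := hx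
      have h0 : b 0 ∈ Set.range fun g => τ g x := hx ▸ ⟨1, by simp⟩
      have h1 : ρ (DihedralGroup.r 1) (b 0) ∈ Set.range fun g => τ g x := hx ▸ ⟨_, rfl⟩
      obtain ⟨g₀, hg₀⟩ := h0
      obtain ⟨g₁, hg₁⟩ := h1
      have : τ (g₁ * g₀⁻¹) (b 0) = (ζ : ZMod p) • b 0 := by
        rw [← h.r_zero, ← hg₁, ← hg₀]
        simp only [← Module.End.mul_apply, ← map_mul, inv_mul_cancel_right]
      obtain ⟨i, -, hi⟩ := h'.exists_pow_of_apply this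
      exact ⟨i.val, by rw [hi]; exact zpow_natCast _ _⟩
    exact fun ho => le_antisymm (key h h' ho) (key h' h ho.symm)
  · intro hz
    unfold fusionOrbits
    congr 1
    funext x
    apply Set.Subset.antisymm
    · rintro _ ⟨g, rfl⟩
      obtain ⟨g', hg'⟩ := range_subset_of_mem_zpowers h h'
        (hz ▸ Subgroup.mem_zpowers ζ) g
      exact ⟨g', by simp only [hg']⟩
    · rintro _ ⟨g, rfl⟩
      obtain ⟨g', hg'⟩ := range_subset_of_mem_zpowers h' h
        (hz ▸ Subgroup.mem_zpowers η) g
      exact ⟨g', by simp only [hg']⟩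

/-- In a field, an element of order `k` generates the full group of `k`-th roots of unity. -/
theorem zpowers_eq_iff_orderOf_eq (ζ η : (ZMod p)ˣ) :
    Subgroup.zpowers ζ = Subgroup.zpowers η ↔ orderOf ζ = orderOf η := by
  constructor
  · intro h
    rw [← Nat.card_zpowers, ← Nat.card_zpowers, h]
  · intro h
    have : NeZero (orderOf ζ) := ⟨(orderOf_pos ζ).ne'⟩
    rw [(IsPrimitiveRoot.orderOf ζ).zpowers_eq, (h ▸ IsPrimitiveRoot.orderOf η :
      IsPrimitiveRoot η (orderOf ζ)).zpowers_eq]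

theorem haveSameFusion_iff {φ₁ φ₂ : Rep2 n p} (h : HasStdBasis φ₁ ζ) (h' : HasStdBasis φ₂ η) :
    HaveSameFusion φ₁ φ₂ ↔ orderOf ζ = orderOf η := by
  constructor
  · rintro ⟨τ₁, τ₂, ⟨e₁⟩, ⟨e₂⟩, ⟨ζ', hr, hs⟩, ⟨η', hr', hs'⟩, ho⟩
    have b₁ := isStdBasis_of_matrix hr hs
    have b₂ := isStdBasis_of_matrix hr' hs'
    have := (zpowers_eq_iff_orderOf_eq _ _).1 ((fusionOrbits_eq_iff b₁ b₂).1 ho)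
    have o₁ : orderOf ζ' = orderOf ζ := by
      rcases (h.of_equiv e₁).eq_or_eq_inv ⟨_, b₁⟩ with h | h <;> rw [h]
      exact orderOf_inv ζ
    have o₂ : orderOf η' = orderOf η := by
      rcases (h'.of_equiv e₂).eq_or_eq_inv ⟨_, b₂⟩ with h | h <;> rw [h]
      exact orderOf_inv η
    rw [← o₁, ← o₂, this]
  · intro ho
    refine ⟨stdRep h.pow_eq_one, stdRep h'.pow_eq_one, h.nonempty_equiv (hasStdBasis_stdRep _),
      h'.nonempty_equiv (hasStdBasis_stdRep _), isStandardForm_stdRep _, isStandardForm_stdRep _, ?_⟩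
    exact (fusionOrbits_eq_iff (isStdBasis_stdRep _) (isStdBasis_stdRep _)).2
      ((zpowers_eq_iff_orderOf_eq _ _).2 ho)

end KernelsAndOrbits

/-! ### Orders of elements and of their squares. -/

section Orders

variable {p : ℕ} [Fact p.Prime]

theorem neg_one_ne_one_units (hp2 : p ≠ 2) : (-1 : (ZMod p)ˣ) ≠ 1 := by
  intro h
  have h1 : (-1 : ZMod p) = 1 := by simpa using congrArg Units.val h
  have : Fact (2 < p) := ⟨lt_of_le_of_ne (Fact.out : p.Prime).two_le hp2.symm⟩
  exact ZMod.neg_one_ne_one h1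

theorem orderOf_neg_of_odd (hp2 : p ≠ 2) {η : (ZMod p)ˣ} (h : Odd (orderOf η)) :
    orderOf (-η) = 2 * orderOf η := by
  have h2 : orderOf (-1 : (ZMod p)ˣ) = 2 :=
    orderOf_eq_prime (by simp) (neg_one_ne_one_units hp2)
  rw [← neg_one_mul, (Commute.all _ _).orderOf_mul_eq_mul_orderOf_of_coprime, h2]
  rw [h2]
  exact Nat.coprime_two_left.2 h

theorem orderOf_sq_of_even {η : (ZMod p)ˣ} (h : Even (orderOf η)) :
    2 * orderOf (η ^ 2) = orderOf η := by
  rw [orderOf_pow, Nat.gcd_eq_right h.two_dvd]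
  exact Nat.mul_div_cancel' h.two_dvd

theorem orderOf_sq_of_odd {η : (ZMod p)ˣ} (h : Odd (orderOf η)) :
    orderOf (η ^ 2) = orderOf η :=
  Nat.Coprime.orderOf_pow (Nat.coprime_two_right.2 h)

/-- If the squares of two elements have the same order, so do the elements up to sign. -/
theorem orderOf_eq_or_eq_neg (hp2 : p ≠ 2) {ξ η : (ZMod p)ˣ}
    (h : orderOf (ξ ^ 2) = orderOf (η ^ 2)) :
    orderOf ξ = orderOf η ∨ orderOf ξ = orderOf (-η) := by
  rcases Nat.even_or_odd (orderOf ξ) with hx | hx <;>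
    rcases Nat.even_or_odd (orderOf η) with he | he
  · left
    rw [← orderOf_sq_of_even hx, ← orderOf_sq_of_even he, h]
  · right
    rw [← orderOf_sq_of_even hx, orderOf_neg_of_odd hp2 he, h, orderOf_sq_of_odd he]
  · right
    -- Here `η` has twice the odd order of `ξ`, so this power is the element of order two, and an
    -- odd power of `-η` becomes trivial.
    have hm : η ^ orderOf ξ = -1 := by
      have h1 : (η ^ orderOf ξ) ^ 2 = 1 := by
        rw [← pow_mul, mul_comm, pow_mul, ← orderOf_sq_of_odd hx, h, pow_orderOf_eq_one]
      have h2 : η ^ orderOf ξ ≠ 1 := by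
        intro h2
        have h3 := orderOf_dvd_of_pow_eq_one h2
        exact (Nat.not_even_iff_odd.2 hx) (even_iff_two_dvd.2 (he.two_dvd.trans h3))
      have h3 : ((η ^ orderOf ξ : (ZMod p)ˣ) : ZMod p) ^ 2 = 1 := by
        rw [← Units.val_pow_eq_pow_val, h1, Units.val_one]
      rcases sq_eq_one_iff.1 h3 with h4 | h4
      · exact absurd (Units.ext h4) h2
      · exact Units.ext h4
    apply Nat.dvd_antisymm
    · rw [← orderOf_sq_of_odd hx, h, ← neg_sq]
      exact orderOf_pow_dvd 2
    · apply orderOf_dvd_of_pow_eq_one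
      rw [hx.neg_pow, hm, neg_neg]
  · left
    rw [← orderOf_sq_of_odd hx, ← orderOf_sq_of_odd he, h]

end Orders

/-! ### Fibres of `T` and the three parts of the theorem. -/

section Main

variable {n p : ℕ} [NeZero n] [Fact p.Prime]

/-- Squaring commutes with inversion, so the ambiguity of the parameter of `ψ` does no harm. -/
theorem exists_isT_iff_equiv (hp : p ≡ 1 [MOD n]) {ψ : Rep2 n p} (hψ : ψ.IsIrreducible) :
    ∃ φ : Rep2 n p, ∀ φ' : Rep2 n p, IsT ψ φ' ↔ Nonempty (φ'.Equiv φ) := by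
  obtain ⟨η, hη⟩ := exists_hasStdBasis hp hψ
  have h2 : (η ^ 2) ^ n = 1 := by rw [← pow_mul, mul_comm, pow_mul, hη.pow_eq_one, one_pow]
  refine ⟨stdRep h2, fun φ' => ?_⟩
  rw [isT_iff_exists]
  constructor
  · rintro ⟨ξ, h, h'⟩
    rcases hη.eq_or_eq_inv h with rfl | rfl
    · exact h'.nonempty_equiv (hasStdBasis_stdRep h2)
    · have h'' := h'.inv
      rw [inv_pow, inv_inv] at h''
      exact h''.nonempty_equiv (hasStdBasis_stdRep h2)
  · rintro ⟨e⟩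
    exact ⟨η, hη, (hasStdBasis_stdRep h2).of_equiv e.symm⟩

/-- Every preimage under `T` of an irreducible representation is irreducible. -/
theorem isIrreducible_of_sq_eq {ψ φ : Rep2 n p} {ζ η : (ZMod p)ˣ} (hφ : HasStdBasis φ ζ)
    (hi : φ.IsIrreducible) (hψ : HasStdBasis ψ η) (h : η ^ 2 = ζ) : ψ.IsIrreducible := by
  refine hψ.isIrreducible fun h1 => hφ.sq_ne_one hi ?_
  rw [← h, h1, one_pow]

/-- `(n + 1) / 2` is the inverse of `2` modulo the odd number `n`. -/
theorem pow_half_sq {ζ : (ZMod p)ˣ} (hn : Odd n) (hζ : ζ ^ n = 1) : (ζ ^ ((n + 1) / 2)) ^ 2 = ζ := by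
  rw [← pow_mul, Nat.div_mul_cancel hn.add_one.two_dvd, pow_succ, hζ, one_mul]

/-- For odd `n` the map `T` is bijective. -/
theorem exists_preimage_iff_equiv (hp : p ≡ 1 [MOD n]) (hn : Odd n) {φ : Rep2 n p}
    (hφ : φ.IsIrreducible) : ∃ ψ : Rep2 n p, ∀ ψ' : Rep2 n p,
      (ψ'.IsIrreducible ∧ IsT ψ' φ) ↔ Nonempty (ψ'.Equiv ψ) := by
  obtain ⟨ζ, hζ⟩ := exists_hasStdBasis hp hφ
  have h1 : (ζ ^ ((n + 1) / 2)) ^ n = 1 := by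
    rw [← pow_mul, mul_comm, pow_mul, hζ.pow_eq_one, one_pow]
  refine ⟨stdRep h1, fun ψ' => ?_⟩
  rw [isT_iff hζ]
  constructor
  · rintro ⟨-, η, hη, hz⟩
    have : η = ζ ^ ((n + 1) / 2) := by
      rw [← hz, ← pow_mul, mul_comm, pow_mul, pow_half_sq hn hη.pow_eq_one]
    subst this
    exact hη.nonempty_equiv (hasStdBasis_stdRep h1)
  · rintro ⟨e⟩
    have hs := (hasStdBasis_stdRep h1).of_equiv e.symm
    have h2 := pow_half_sq hn hζ.pow_eq_one
    exact ⟨isIrreducible_of_sq_eq hζ hφ hs h2, _, hs, h2⟩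

theorem orderOf_odd {η : (ZMod p)ˣ} (hn : Odd n) (hη : η ^ n = 1) : Odd (orderOf η) :=
  hn.of_dvd_nat (orderOf_dvd_of_pow_eq_one hη)

/-- For odd `n`, having the same fusion means having preimages with the same kernel. -/
theorem haveSameFusion_iff_ker_eq (hp : p ≡ 1 [MOD n]) (hn : Odd n) {φ₁ φ₂ ψ₁ ψ₂ : Rep2 n p}
    (h₁ : φ₁.IsIrreducible) (h₂ : φ₂.IsIrreducible) (hT₁ : IsT ψ₁ φ₁) (hT₂ : IsT ψ₂ φ₂) :
    HaveSameFusion φ₁ φ₂ ↔ MonoidHom.ker ψ₁ = MonoidHom.ker ψ₂ := by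
  obtain ⟨ζ₁, hζ₁⟩ := exists_hasStdBasis hp h₁
  obtain ⟨ζ₂, hζ₂⟩ := exists_hasStdBasis hp h₂
  obtain ⟨η₁, hη₁, rfl⟩ := (isT_iff hζ₁).1 hT₁
  obtain ⟨η₂, hη₂, rfl⟩ := (isT_iff hζ₂).1 hT₂
  rw [haveSameFusion_iff hζ₁ hζ₂, ker_eq_iff_orderOf_eq hη₁ hη₂,
    orderOf_sq_of_odd (orderOf_odd hn hη₁.pow_eq_one),
    orderOf_sq_of_odd (orderOf_odd hn hη₂.pow_eq_one)]

/-- The set of kernels of the irreducible preimages of `φ` under `T`. -/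
def preimageKernels (φ : Rep2 n p) : Set (Subgroup (DihedralGroup n)) :=
  {K | ∃ ψ : Rep2 n p, ψ.IsIrreducible ∧ IsT ψ φ ∧ K = MonoidHom.ker ψ}

/-- For even `n`, both square roots `η₂` and `-η₂` are `n`-th roots of unity and so parameters of
preimages of `φ₂`. By `orderOf_eq_or_eq_neg` one of them has the order of `η₁`. -/
theorem preimageKernels_subset (hp2 : p ≠ 2) (hn : Even n) {φ₁ φ₂ : Rep2 n p} {ζ₁ ζ₂ : (ZMod p)ˣ}
    (hζ₁ : HasStdBasis φ₁ ζ₁) (hζ₂ : HasStdBasis φ₂ ζ₂) (hi : φ₂.IsIrreducible)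
    (hT : ∃ ψ : Rep2 n p, ψ.IsIrreducible ∧ IsT ψ φ₂) (ho : orderOf ζ₁ = orderOf ζ₂) :
    preimageKernels φ₁ ⊆ preimageKernels φ₂ := by
  rintro K ⟨ψ, -, hψT, rfl⟩
  obtain ⟨ψ₂, -, hψ₂⟩ := hT
  obtain ⟨η₁, hη₁, rfl⟩ := (isT_iff hζ₁).1 hψT
  obtain ⟨η₂, hη₂, rfl⟩ := (isT_iff hζ₂).1 hψ₂
  have key : ∀ ξ : (ZMod p)ˣ, ξ ^ n = 1 → ξ ^ 2 = η₂ ^ 2 → orderOf η₁ = orderOf ξ →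
      MonoidHom.ker ψ ∈ preimageKernels φ₂ := by
    intro ξ hξ hsq ho
    have hs := hasStdBasis_stdRep hξ
    exact ⟨stdRep hξ, isIrreducible_of_sq_eq hζ₂ hi hs hsq, (isT_iff hζ₂).2 ⟨ξ, hs, hsq⟩,
      (ker_eq_iff_orderOf_eq hη₁ hs).2 ho⟩
  rcases orderOf_eq_or_eq_neg hp2 ho with h | h
  · exact key η₂ hη₂.pow_eq_one rfl h
  · exact key (-η₂) (by rw [hn.neg_pow, hη₂.pow_eq_one]) (neg_sq _) h

/-- For even `n` and classes in `Ω`, having the same fusion means having the same set of kernels of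
preimages. -/
theorem haveSameFusion_iff_preimageKernels_eq (hp : p ≡ 1 [MOD n]) (hp2 : p ≠ 2) (hn : Even n)
    {φ₁ φ₂ : Rep2 n p} (h₁ : InOmega φ₁) (h₂ : InOmega φ₂) :
    HaveSameFusion φ₁ φ₂ ↔ preimageKernels φ₁ = preimageKernels φ₂ := by
  obtain ⟨ζ₁, hζ₁⟩ := exists_hasStdBasis hp h₁.1
  obtain ⟨ζ₂, hζ₂⟩ := exists_hasStdBasis hp h₂.1
  rw [haveSameFusion_iff hζ₁ hζ₂]
  constructor
  · intro ho
    exact (preimageKernels_subset hp2 hn hζ₁ hζ₂ h₂.1 (h₂.2 hn) ho).antisymm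
      (preimageKernels_subset hp2 hn hζ₂ hζ₁ h₁.1 (h₁.2 hn) ho.symm)
  · intro hK
    obtain ⟨ψ₁, hψ₁, hT₁⟩ := h₁.2 hn
    have hmem : MonoidHom.ker ψ₁ ∈ preimageKernels φ₂ := hK ▸ ⟨ψ₁, hψ₁, hT₁, rfl⟩
    obtain ⟨ψ₂, -, hT₂, hker⟩ := hmem
    obtain ⟨η₁, hη₁, rfl⟩ := (isT_iff hζ₁).1 hT₁
    obtain ⟨η₂, hη₂, rfl⟩ := (isT_iff hζ₂).1 hT₂
    -- A single common kernel suffices, since the order of `η` determines that of `η ^ 2`.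
    rw [orderOf_pow, orderOf_pow, (ker_eq_iff_orderOf_eq hη₁ hη₂).1 hker]

end Main

end DihedralFusion

open DihedralFusion
/-- First the map `T` is well defined on isomorphism classes of irreducible representations;
then parts (a), (b) (where the fibre of `T` is a single class) and (c). -/
theorem theorem4p3 (n p : ℕ) (hn : 3 ≤ n) [Fact p.Prime] (hp : p ≡ 1 [MOD n]) :
    (∀ ψ : Rep2 n p, ψ.IsIrreducible →
      ∃ φ : Rep2 n p, ∀ φ' : Rep2 n p, IsT ψ φ' ↔ Nonempty (φ'.Equiv φ)) ∧
    (∀ φ : Rep2 n p, InOmega φ →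
      ∀ (Γ : Type) [Group Γ]
        (S : GroupExtension (Multiplicative (Fin 2 → ZMod p)) Γ (DihedralGroup n)),
        ActsBy S φ →
        ∀ ψ : Rep2 n p, ψ.IsIrreducible →
          (IsCohomologicallyMaximal S.rightHom ψ ↔ IsT ψ φ)) ∧
    (Odd n →
      (∀ φ : Rep2 n p, φ.IsIrreducible →
        ∃ ψ : Rep2 n p, ∀ ψ' : Rep2 n p,
          (ψ'.IsIrreducible ∧ IsT ψ' φ) ↔ Nonempty (ψ'.Equiv ψ)) ∧
      (∀ φ₁ φ₂ ψ₁ ψ₂ : Rep2 n p,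
        φ₁.IsIrreducible → φ₂.IsIrreducible → ψ₁.IsIrreducible → ψ₂.IsIrreducible →
        IsT ψ₁ φ₁ → IsT ψ₂ φ₂ →
        (HaveSameFusion φ₁ φ₂ ↔ MonoidHom.ker ψ₁ = MonoidHom.ker ψ₂))) ∧
    (Even n →
      ∀ φ₁ φ₂ : Rep2 n p, InOmega φ₁ → InOmega φ₂ →
        (HaveSameFusion φ₁ φ₂ ↔
          {K | ∃ ψ : Rep2 n p, ψ.IsIrreducible ∧ IsT ψ φ₁ ∧ K = MonoidHom.ker ψ} =
          {K | ∃ ψ : Rep2 n p, ψ.IsIrreducible ∧ IsT ψ φ₂ ∧ K = MonoidHom.ker ψ})) := by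
  have : NeZero n := ⟨by omega⟩
  -- `n` divides the positive number `p - 1`; hence `p` is odd and prime to `n`.
  have hlt : n < p := by
    have h1 := (Fact.out : p.Prime).one_lt
    have := Nat.le_of_dvd (by omega) ((Nat.modEq_iff_dvd' h1.le).1 hp.symm)
    omega
  have hp2 : p ≠ 2 := by omega
  have hpn : p.Coprime n := Nat.coprime_of_lt_prime (by omega) hlt Fact.out
  refine ⟨fun ψ hψ => exists_isT_iff_equiv hp hψ, ?_, fun hodd =>
    ⟨fun φ hφ => exists_preimage_iff_equiv hp hodd hφ, fun φ₁ φ₂ ψ₁ ψ₂ h₁ h₂ _ _ hT₁ hT₂ =>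
      haveSameFusion_iff_ker_eq hp hodd h₁ h₂ hT₁ hT₂⟩, fun heven φ₁ φ₂ h₁ h₂ =>
    haveSameFusion_iff_preimageKernels_eq hp hp2 heven h₁ h₂⟩
  intro φ hφ Γ _ S hS ψ hψ
  have hpre : ∃ ψ₀ : Rep2 n p, ψ₀.IsIrreducible ∧ IsT ψ₀ φ := by
    rcases Nat.even_or_odd n with heven | hodd
    · exact hφ.2 heven
    · obtain ⟨ψ₀, h⟩ := exists_preimage_iff_equiv hp hodd hφ.1
      exact ⟨ψ₀, (h ψ₀).2 ⟨Representation.Equiv.refl ψ₀⟩⟩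
  obtain ⟨ψ₀, hψ₀, hT⟩ := hpre
  exact isCohomologicallyMaximal_iff_isT hp hp2 hpn hφ.1 hS hψ₀ hT hψ
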